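/- Let $n\ge 1$, let $\mathbb B^n=\{z\in\mathbb C^n:\|z\|<1\}$ be the Euclidean unit ball, let $e_1,\dots,e_n$ be the standard basis of $\mathbb C^n$, and $\langle\cdot,\cdot\rangle$ the standard Hermitian product, so that $z_1=\langle z,e_1\rangle$. We use the following definitions. A holomorphic map $G:\mathbb B^n\to\mathbb C^n$ is an *infinitesimal generator* if for every $z_0\in\mathbb B^n$ the Cauchy problem $\dot x(t)=G(x(t))$, $x(0)=z_0$, has a solution $x:[0,+\infty)\to\mathbb B^n$. For $R\ge1$ the *Korányi region* of vertex $e_1$ and amplitude $R$ is $K(e_1,R)=\{z\in\mathbb B^n: |1-z_1|\le \frac R2(1-\|z\|^2)\}$. A function on $\mathbb B^n$ is *bounded in any Korányi region* if for every $R\ge 1$ it is bounded on $K(e_1,R)$. A function $f:\mathbb B^n\to\mathbb C$ has *restricted $K$-limit* $L$ at $e_1$, written $\angle_K\lim_{z\to e_1}f(z)=L$, if $f(z_k)\to L$ for every sequence $\{z_k\}\subset\mathbb B^n$ converging to $e_1$ such that $\|z_k-\langle z_k,e_1\rangle e_1\|^2/(1-|\langle z_k,e_1\rangle|^2)\to0$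 and $\langle z_k,e_1\rangle\to1$ non-tangentially in the unit disc (i.e. there is $C>0$ with $|\langle z_k,e_1\rangle-1|\le C(1-|\langle z_k,e_1\rangle|^2)$ for all $k$). Let $u(z)=-\frac{1-\|z\|^2}{|1-z_1|^2}$ for $z\in\mathbb B^n$, and let $du_z$ be its real differential. The point $e_1$ is a *boundary regular null point* of an infinitesimal generator $G$ if there is $b\in\mathbb R$ with $du_z\cdot G(z)+b\,u(z)\le0$ for all $z\in\mathbb B^n$; in this case the real number $\beta=-\inf_{z\in\mathbb B^n}\frac{du_z\cdot G(z)}{u(z)}$ is the *dilation* of $G$ at $e_1$. **Theorem.** Let $G:\mathbb B^n\to\mathbb C^n$ be an infinitesimal generator. Suppose that $z\mapsto\frac{|\langle G(z),e_1\rangle|}{|z_1-1|}$ is bounded in any Korányi region, and that $z\mapsto\frac{|\langle G(z),e_j\rangle|}{|z_1-1|^{1/2}}$ is bounded in any Korányi region for $j=2,\dots,n$. Then $e_1$ is a boundary regular null point of $G$. Moreover, let $\beta\in\mathbb R$ be the dilation of $G$ at $e_1$. Then, with $(1-z_1)^{1/2}$ the principal branch, - (1$'$) $\langle dG_z(e_1),e_1\rangle$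 and $\langle dG_z(e_h),e_k\rangle$ are bounded in any Korányi region for $h,k=2,\dots,n$; - (1$''$) $\langle dG_z(e_j),e_1\rangle/(1-z_1)^{1/2}$ is bounded in any Korányi region for $j=2,\dots,n$; - (1$'''$) $(1-z_1)^{1/2}\langle dG_z(e_1),e_j\rangle$ is bounded in any Korányi region for $j=2,\dots,n$; - (2) $\angle_K\lim_{z\to e_1}\frac{\langle G(z),e_1\rangle}{z_1-1}=\beta$; - (3) $\angle_K\lim_{z\to e_1}\langle dG_z(e_1),e_1\rangle=\beta$; - (4) $\angle_K\lim_{z\to e_1}\langle dG_z(e_j),e_1\rangle=0$ for $j=2,\dots,n$. -/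

import Mathlib

open Filter Topology

noncomputable section

namespace UnitBall

/-- `ℂⁿ` with the Euclidean norm. -/
abbrev Cn (n : ℕ) : Type := EuclideanSpace ℂ (Fin n)

/-- The open unit ball `𝔹ⁿ` of `ℂⁿ`. -/
def ball (n : ℕ) : Set (Cn n) := Metric.ball 0 1

/-- The `j`-th vector of the standard basis of `ℂⁿ` (indices start at `0`, so `e 0` is the
vector usually called `e₁`). For `w : Cn n` the coordinate `w j` is `⟨w, e j⟩`. -/
def e {n : ℕ} (j : Fin n) : Cn n := EuclideanSpace.single j (1 : ℂ)

/-- A holomorphic vector field `G` on `𝔹ⁿ` is an infinitesimal generator if every Cauchy problem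
`x' = G(x)`, `x(0) = z₀ ∈ 𝔹ⁿ`, has a solution `x : [0, ∞) → 𝔹ⁿ`. Values of `G` outside the ball
are irrelevant. -/
def IsInfinitesimalGenerator {n : ℕ} (G : Cn n → Cn n) : Prop :=
  DifferentiableOn ℂ G (ball n) ∧
    ∀ z₀ ∈ ball n, ∃ x : ℝ → Cn n, x 0 = z₀ ∧
      ∀ t : ℝ, 0 ≤ t → x t ∈ ball n ∧ HasDerivWithinAt x (G (x t)) (Set.Ici 0) t

variable {n : ℕ} [NeZero n]

/-- The Korányi region of vertex `e₁` and amplitude `R`. -/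
def koranyi (n : ℕ) [NeZero n] (R : ℝ) : Set (Cn n) :=
  {z | z ∈ ball n ∧ ‖1 - z 0‖ ≤ R / 2 * (1 - ‖z‖ ^ 2)}

/-- `f` is bounded in every Korányi region of vertex `e₁` (the bound may depend on the region). -/
def BoundedInKoranyi {F : Type*} [Norm F] (f : Cn n → F) : Prop :=
  ∀ R : ℝ, 1 ≤ R → ∃ C : ℝ, ∀ z ∈ koranyi n R, ‖f z‖ ≤ C

/-- `f` has restricted `K`-limit `L` at `e₁`. -/
def HasRestrictedKLimit (f : Cn n → ℂ) (L : ℂ) : Prop :=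
  ∀ z : ℕ → Cn n, (∀ k, z k ∈ ball n) → Tendsto z atTop (𝓝 (e 0)) →
    Tendsto (fun k => ‖z k - (z k 0) • (e 0 : Cn n)‖ ^ 2 / (1 - ‖z k 0‖ ^ 2)) atTop (𝓝 0) →
    (∃ C : ℝ, 0 < C ∧ ∀ k, ‖z k 0 - 1‖ ≤ C * (1 - ‖z k 0‖ ^ 2)) →
    Tendsto (fun k => f (z k)) atTop (𝓝 L)

/-- The pluricomplex Poisson kernel of the ball with pole at `e₁`. -/
def poissonKernel (z : Cn n) : ℝ := -((1 - ‖z‖ ^ 2) / ‖1 - z 0‖ ^ 2)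

/-- `e₁` is a boundary regular null point of `G`; the differential of the kernel is the real one. -/
def IsBRNP (G : Cn n → Cn n) : Prop :=
  ∃ b : ℝ, ∀ z ∈ ball n,
    fderiv ℝ (poissonKernel (n := n)) z (G z) + b * poissonKernel z ≤ 0

/-- The dilation of `G` at `e₁`. The infimum is over a non-empty set, which is bounded below exactly
when `e₁` is a boundary regular null point of `G`. -/
def dilation (G : Cn n → Cn n) : ℝ :=
  -sInf ((fun z => fderiv ℝ (poissonKernel (n := n)) z (G z) / poissonKernel z) '' ball n)

end UnitBall

end

/-
The flow of an infinitesimal generator `G` is holomorphic, so its time-`t` maps satisfy the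
Schwarz–Pick inequality; differentiating at `t = 0` gives an inequality between the values of `G`
at two points of the ball. Letting one of them tend to `e₁` along the radius bounds minus the
logarithmic derivative of the Poisson kernel along `G` by the lower radial limit of the real part
of `q = G₁ / (z₁ - 1)`. Hence `e₁` is a boundary regular null point, and the real part of `q` has
radial limit `β`. A half-plane Schwarz–Pick argument upgrades this to a nontangential limit of `q`
along the slice `ℂ e₁`, and the Schwarz lemma on transverse balls to a restricted `K`-limit. The
derivatives are controlled by the Cauchy estimates on discs of radius comparable to `|1 - z₁|` in
the normal direction and to `|1 - z₁| ^ (1 / 2)` in the tangential ones.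
-/

noncomputable section

namespace HolomorphicFlow

open Metric Set
open scoped NNReal

section ApproximateTrajectories

variable {E : Type*} [NormedAddCommGroup E] [NormedSpace ℝ E]

lemma tendsto_gronwallBound_zero {ι : Type*} {l : Filter ι} {δ ε : ι → ℝ} (K x : ℝ)
    (hδ : Tendsto δ l (𝓝 0)) (hε : Tendsto ε l (𝓝 0)) :
    Tendsto (fun i => gronwallBound (δ i) K (ε i) x) l (𝓝 0) := by
  rcases eq_or_ne K 0 with rfl | hK
  · simpa [gronwallBound_K0] using hδ.add (hε.mul_const x)
  · simpa [gronwallBound_of_K_ne_0 hK] using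
      (hδ.mul_const (Real.exp (K * x))).add ((hε.div_const K).mul_const (Real.exp (K * x) - 1))

lemma exists_tendsto_of_approx_trajectories [CompleteSpace E] {ι : Type*} {l : Filter ι} [l.NeBot]
    {v : ℝ → E → E} {K : ℝ≥0} {T : ℝ} (hT : 0 ≤ T)
    (hv : ∀ t ∈ Ico 0 T, LipschitzWith K (v t)) {q q' : ι → ℝ → E} {ε : ι → ℝ}
    (hcont : ∀ᶠ i in l, ContinuousOn (q i) (Icc 0 T))
    (hderiv : ∀ᶠ i in l, ∀ t ∈ Ico 0 T, HasDerivWithinAt (q i) (q' i t) (Ici t) t)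
    (happrox : ∀ᶠ i in l, ∀ t ∈ Ico 0 T, dist (q' i t) (v t (q i t)) ≤ ε i)
    (hε : Tendsto ε l (𝓝 0)) {q₀ : E} (hinit : Tendsto (fun i => q i 0) l (𝓝 q₀)) :
    ∃ q₁, Tendsto (fun i => q i T) l (𝓝 q₁) := by
  refine cauchy_map_iff_exists_tendsto.1 (cauchy_map_iff'.2 ?_)
  rw [tendsto_uniformity_iff_dist_tendsto_zero]
  have hdist : Tendsto (fun p : ι × ι => dist (q p.1 0) (q p.2 0)) (l ×ˢ l) (𝓝 0) := by
    simpa using (hinit.comp tendsto_fst).dist (hinit.comp tendsto_snd)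
  have herror : Tendsto (fun p : ι × ι => ε p.1 + ε p.2) (l ×ˢ l) (𝓝 0) := by
    simpa using (hε.comp tendsto_fst).add (hε.comp tendsto_snd)
  refine squeeze_zero' (Eventually.of_forall fun _ => dist_nonneg) ?_
    (tendsto_gronwallBound_zero K (T - 0) hdist herror)
  have hq := hcont.and (hderiv.and happrox)
  filter_upwards [hq.prod_mk hq] with ⟨i, j⟩ ⟨⟨hci, hdi, hai⟩, hcj, hdj, haj⟩
  exact dist_le_of_approx_trajectories_ODE_of_mem (s := fun _ => univ)
    (fun t ht => (hv t ht).lipschitzOnWith) hci hdi hai (fun _ _ => mem_univ _) hcj hdj haj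
    (fun _ _ => mem_univ _) le_rfl T (right_mem_Icc.2 hT)

end ApproximateTrajectories

section BoundedHolomorphic

lemma mapsTo_closedBall_of_norm_le {E F : Type*} [PseudoMetricSpace E] [SeminormedAddCommGroup F]
    {f : E → F} {x : E} {δ M : ℝ} (hδ : 0 < δ) (hM : ∀ y ∈ ball x δ, ‖f y‖ ≤ M) :
    MapsTo f (ball x δ) (closedBall (f x) (2 * M)) := fun y hy => by
  rw [mem_closedBall, dist_eq_norm]
  linarith [norm_sub_le (f y) (f x), hM y hy, hM x (mem_ball_self hδ)]

variable {E F : Type*} [NormedAddCommGroup E] [NormedSpace ℂ E] [NormedAddCommGroup F]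
  [NormedSpace ℂ F] {f : E → F} {x y : E} {δ M : ℝ}

lemma norm_fderiv_le_of_norm_le (hδ : 0 < δ) (hf : DifferentiableOn ℂ f (ball x δ))
    (hM : ∀ y ∈ ball x δ, ‖f y‖ ≤ M) : ‖fderiv ℂ f x‖ ≤ 2 * M / δ :=
  Complex.norm_fderiv_le_div_of_mapsTo_ball hf (mapsTo_closedBall_of_norm_le hδ hM) hδ

lemma norm_sub_le_of_norm_le (hf : DifferentiableOn ℂ f (ball x δ))
    (hM : ∀ y ∈ ball x δ, ‖f y‖ ≤ M) (hy : y ∈ ball x δ) :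
    ‖f y - f x‖ ≤ 2 * M / δ * ‖y - x‖ := by
  simpa only [dist_eq_norm] using Complex.dist_le_div_mul_dist_of_mapsTo_ball hf
    (mapsTo_closedBall_of_norm_le (pos_of_mem_ball hy) hM) hy

lemma norm_sub_sub_fderiv_le_of_norm_le (hf : DifferentiableOn ℂ f (ball x δ))
    (hM : ∀ y ∈ ball x δ, ‖f y‖ ≤ M) (hy : y ∈ ball x δ) :
    ‖f y - f x - fderiv ℂ f x (y - x)‖ ≤ 4 * M / δ ^ 2 * ‖y - x‖ ^ 2 := by
  have hδ : 0 < δ := pos_of_mem_ball hy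
  set g : E → F := f - ⇑(fderiv ℂ f x)
  have hg : ∀ y, g y - g x = f y - f x - fderiv ℂ f x (y - x) := fun y => by
    simp only [g, Pi.sub_apply, map_sub]; abel
  have hmaps : MapsTo g (ball x δ) (closedBall (g x) (4 * M)) := fun w hw => by
    have hlin : ‖fderiv ℂ f x (w - x)‖ ≤ 2 * M := by
      refine (((fderiv ℂ f x).le_of_opNorm_le_of_le (norm_fderiv_le_of_norm_le hδ hf hM)
        (mem_ball_iff_norm.1 hw).le)).trans_eq ?_
      field_simp
    have hfw := mapsTo_closedBall_of_norm_le hδ hM hw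
    rw [mem_closedBall, dist_eq_norm] at hfw ⊢
    rw [hg]
    linarith [norm_sub_le (f w - f x) (fderiv ℂ f x (w - x))]
  have hlittle : (fun w => g w - g x) =o[𝓝 x] fun w => ‖w - x‖ ^ 1 := by
    simp only [hg, pow_one]
    exact (hf.differentiableAt (ball_mem_nhds x hδ)).hasFDerivAt.isLittleO.norm_right
  have h := Complex.dist_le_mul_div_pow_of_mapsTo_ball_of_isLittleO
    (hf.sub (fderiv ℂ f x).differentiable.differentiableOn) hmaps hlittle hy
  rw [dist_eq_norm, dist_eq_norm, hg] at h
  refine h.trans_eq ?_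
  rw [div_pow]
  ring

end BoundedHolomorphic

variable {E : Type*} [NormedAddCommGroup E] [NormedSpace ℂ E]

/-- A solution of the autonomous equation `x' = G(x)` which stays in `Ω` for all times `t ≥ 0`. -/
def IsForwardTrajectory (G : E → E) (Ω : Set E) (x : ℝ → E) : Prop :=
  ∀ t : ℝ, 0 ≤ t → x t ∈ Ω ∧ HasDerivWithinAt x (G (x t)) (Ici 0) t

variable {G : E → E} {Ω : Set E} {x y : ℝ → E} {T : ℝ}

namespace IsForwardTrajectory

lemma continuousOn_Icc (hx : IsForwardTrajectory G Ω x) (T : ℝ) : ContinuousOn x (Icc 0 T) :=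
  fun t ht => ((hx t ht.1).2.mono Icc_subset_Ici_self).continuousWithinAt

lemma hasDerivWithinAt_Ici (hx : IsForwardTrajectory G Ω x) {t : ℝ} (ht : 0 ≤ t) :
    HasDerivWithinAt x (G (x t)) (Ici t) t :=
  (hx t ht).2.mono (Ici_subset_Ici.2 ht)

lemma exists_uniform_bound (hx : IsForwardTrajectory G Ω x) (hΩ : IsOpen Ω)
    (hG : ContinuousOn G Ω) (T : ℝ) :
    ∃ δ > 0, ∃ M > 0, ∀ t ∈ Icc 0 T, ball (x t) δ ⊆ Ω ∧ ∀ y ∈ ball (x t) δ, ‖G y‖ ≤ M := by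
  have hcompact : IsCompact (x '' Icc 0 T) := isCompact_Icc.image_of_continuousOn
    (hx.continuousOn_Icc T)
  have hmem : x '' Icc 0 T ⊆ Ω := image_subset_iff.2 fun t ht => (hx t ht.1).1
  obtain ⟨M, hM⟩ := hcompact.exists_bound_of_continuousOn (hG.mono hmem)
  set U : Set E := Ω ∩ G ⁻¹' ball 0 (|M| + 1)
  have hU : IsOpen U := hG.isOpen_inter_preimage hΩ isOpen_ball
  obtain ⟨δ, hδ, hsub⟩ := hcompact.exists_thickening_subset_open hU fun y hy =>
    ⟨hmem hy, mem_ball_zero_iff.2 (by linarith [hM y hy, le_abs_self M])⟩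
  refine ⟨δ, hδ, |M| + 1, by positivity, fun t ht => ?_⟩
  have hball : ball (x t) δ ⊆ U :=
    (ball_subset_thickening (mem_image_of_mem x ht) δ).trans hsub
  exact ⟨fun y hy => (hball hy).1, fun y hy => (mem_ball_zero_iff.1 (hball hy).2).le⟩

lemma norm_sub_le_mul_exp (hx : IsForwardTrajectory G Ω x) (hy : IsForwardTrajectory G Ω y)
    {δ K d : ℝ} (hd : 0 < d) (hK : 0 ≤ K) (hdδ : d * Real.exp ((K + 1) * T) < δ)
    (h0 : ‖y 0 - x 0‖ ≤ d)
    (hLip : ∀ t ∈ Icc 0 T, ∀ w ∈ ball (x t) δ, ‖G w - G (x t)‖ ≤ K * ‖w - x t‖) :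
    ∀ t ∈ Icc 0 T, ‖y t - x t‖ ≤ d * Real.exp ((K + 1) * T) := by
  have hexp_le : ∀ t ≤ T, d * Real.exp ((K + 1) * t) ≤ d * Real.exp ((K + 1) * T) :=
    fun t ht => by gcongr
  intro t ht
  refine le_trans ?_ (hexp_le t ht.2)
  refine image_norm_le_of_norm_deriv_right_lt_deriv_boundary (a := 0) (b := T)
    (f := fun t => y t - x t) (B' := fun t => d * (Real.exp ((K + 1) * t) * ((K + 1) * 1)))
    ((hy.continuousOn_Icc T).sub (hx.continuousOn_Icc T))
    (fun t ht => (hy.hasDerivWithinAt_Ici ht.1).sub (hx.hasDerivWithinAt_Ici ht.1))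
    (by simpa using h0)
    (fun t => ((hasDerivAt_id t).const_mul (K + 1)).exp.const_mul d)
    (fun t ht heq => ?_) ht
  have hball : y t ∈ ball (x t) δ := by
    rw [mem_ball_iff_norm, heq]
    exact (hexp_le t ht.2.le).trans_lt hdδ
  refine (hLip t (Ico_subset_Icc_self ht) _ hball).trans_lt ?_
  rw [heq, id]
  nlinarith [mul_pos hd (Real.exp_pos ((K + 1) * t))]

end IsForwardTrajectory

variable {X : ℂ → ℝ → E} {a : ℂ}

lemma exists_eventually_norm_sub_le {δ K : ℝ} (hδ : 0 < δ) (hK : 0 ≤ K)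
    (hX : ∀ᶠ s in 𝓝 a, IsForwardTrajectory G Ω (X s))
    (h0 : DifferentiableAt ℂ (fun s => X s 0) a)
    (hLip : ∀ t ∈ Icc 0 T, ∀ w ∈ ball (X a t) δ, ‖G w - G (X a t)‖ ≤ K * ‖w - X a t‖) :
    ∃ A, ∀ᶠ s in 𝓝[≠] a, ∀ t ∈ Icc 0 T,
      ‖X s t - X a t‖ ≤ A * ‖s - a‖ ∧ X s t ∈ ball (X a t) δ := by
  obtain ⟨m, hm, hbound⟩ := h0.hasFDerivAt.isBigO_sub.exists_pos
  set A := m * Real.exp ((K + 1) * T) with hA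
  have hsmall : ∀ᶠ s in 𝓝 a, A * ‖s - a‖ < δ := by
    have hcont : Continuous fun s : ℂ => A * ‖s - a‖ := by fun_prop
    exact (hcont.tendsto a).eventually_lt_const (by simpa using hδ)
  refine ⟨A, ?_⟩
  filter_upwards [nhdsWithin_le_nhds hX, nhdsWithin_le_nhds hbound.bound,
    nhdsWithin_le_nhds hsmall, self_mem_nhdsWithin] with s hs hs0 hsδ hsa t ht
  have hrw : A * ‖s - a‖ = m * ‖s - a‖ * Real.exp ((K + 1) * T) := by rw [hA]; ring
  have hle : ‖X s t - X a t‖ ≤ A * ‖s - a‖ := hrw ▸ hX.self_of_nhds.norm_sub_le_mul_exp hs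
    (mul_pos hm (norm_sub_pos_iff.2 hsa)) hK (hrw ▸ hsδ) hs0 hLip t ht
  exact ⟨hle, mem_ball_iff_norm.2 (hle.trans_lt hsδ)⟩

lemma exists_eventually_dist_slope_le {δ M : ℝ} (hδ : 0 < δ) (hM : 0 ≤ M)
    (hX : ∀ᶠ s in 𝓝 a, IsForwardTrajectory G Ω (X s))
    (h0 : DifferentiableAt ℂ (fun s => X s 0) a)
    (hG : ∀ t ∈ Icc 0 T, DifferentiableOn ℂ G (ball (X a t) δ))
    (hbound : ∀ t ∈ Icc 0 T, ∀ w ∈ ball (X a t) δ, ‖G w‖ ≤ M) :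
    ∃ B, ∀ᶠ s in 𝓝[≠] a, ∀ t ∈ Icc 0 T, dist (slope (fun s => G (X s t)) a s)
      (fderiv ℂ G (X a t) (slope (fun s => X s t) a s)) ≤ B * ‖s - a‖ := by
  obtain ⟨A, hA⟩ := exists_eventually_norm_sub_le hδ (K := 2 * M / δ) (by positivity) hX h0
    fun t ht _ hw => norm_sub_le_of_norm_le (hG t ht) (hbound t ht) hw
  refine ⟨4 * M / δ ^ 2 * A ^ 2, ?_⟩
  filter_upwards [hA, self_mem_nhdsWithin] with s hs hsa t ht
  obtain ⟨hle, hmem⟩ := hs t ht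
  rw [dist_eq_norm, slope_def_module, slope_def_module, map_smul, ← smul_sub, norm_smul,
    norm_inv, inv_mul_le_iff₀ (norm_sub_pos_iff.2 hsa)]
  calc _ ≤ 4 * M / δ ^ 2 * ‖X s t - X a t‖ ^ 2 :=
        norm_sub_sub_fderiv_le_of_norm_le (hG t ht) (hbound t ht) hmem
    _ ≤ 4 * M / δ ^ 2 * (A * ‖s - a‖) ^ 2 := by gcongr
    _ = ‖s - a‖ * (4 * M / δ ^ 2 * A ^ 2 * ‖s - a‖) := by ring

-- The difference quotients of the flow solve the variational equation up to an error of order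
-- `s - a`, so by Grönwall's inequality they form a Cauchy family.
theorem differentiableAt_trajectory [CompleteSpace E] (hΩ : IsOpen Ω)
    (hG : DifferentiableOn ℂ G Ω) (hX : ∀ᶠ s in 𝓝 a, IsForwardTrajectory G Ω (X s))
    (h0 : DifferentiableAt ℂ (fun s => X s 0) a) (hT : 0 ≤ T) :
    DifferentiableAt ℂ (fun s => X s T) a := by
  have ha : IsForwardTrajectory G Ω (X a) := hX.self_of_nhds
  obtain ⟨δ, hδ, M, hM, hball⟩ := ha.exists_uniform_bound hΩ hG.continuousOn T
  have hGδ : ∀ t ∈ Icc 0 T, DifferentiableOn ℂ G (ball (X a t) δ) :=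
    fun t ht => hG.mono (hball t ht).1
  obtain ⟨B, happrox⟩ := exists_eventually_dist_slope_le hδ hM.le hX h0 hGδ
    fun t ht => (hball t ht).2
  have hLip : ∀ t ∈ Ico 0 T, LipschitzWith ⟨2 * M / δ, by positivity⟩ (fderiv ℂ G (X a t)) :=
    fun t ht => (fderiv ℂ G (X a t)).lipschitzWith_of_opNorm_le (norm_fderiv_le_of_norm_le hδ
      (hGδ t (Ico_subset_Icc_self ht)) (hball t (Ico_subset_Icc_self ht)).2)
  have herror : Tendsto (fun s => B * ‖s - a‖) (𝓝[≠] a) (𝓝 0) := by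
    have hcont : Continuous fun s : ℂ => B * ‖s - a‖ := by fun_prop
    exact Tendsto.mono_left (by simpa using hcont.tendsto a) nhdsWithin_le_nhds
  have hX' : ∀ᶠ s in 𝓝[≠] a, IsForwardTrajectory G Ω (X s) := nhdsWithin_le_nhds hX
  obtain ⟨d, hd⟩ := exists_tendsto_of_approx_trajectories hT hLip
    (hX'.mono fun s hs => ((hs.continuousOn_Icc T).sub (ha.continuousOn_Icc T)).const_smul _)
    (hX'.mono fun s hs t ht =>
      ((hs.hasDerivWithinAt_Ici ht.1).sub (ha.hasDerivWithinAt_Ici ht.1)).const_smul _)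
    (happrox.mono fun s hs t ht => hs t (Ico_subset_Icc_self ht)) herror
    h0.hasDerivAt.tendsto_slope
  exact (hasDerivAt_iff_tendsto_slope.2 hd).differentiableAt

end HolomorphicFlow

namespace HilbertBall

open Metric Set ComplexConjugate HolomorphicFlow

lemma one_sub_norm_sq_pos {E : Type*} [SeminormedAddCommGroup E] {z : E} (hz : ‖z‖ < 1) :
    0 < 1 - ‖z‖ ^ 2 :=
  sub_pos.2 (pow_lt_one₀ (norm_nonneg z) hz two_ne_zero)

variable {E F : Type*} [NormedAddCommGroup E] [InnerProductSpace ℂ E]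
  [NormedAddCommGroup F] [InnerProductSpace ℂ F]

/-- The involutive automorphism of the open unit ball which exchanges `0` and `p`. -/
def mobius (p z : E) : E :=
  (1 - inner ℂ p z)⁻¹ •
    (p - (√(1 - ‖p‖ ^ 2) : ℂ) • z - (inner ℂ p z / (1 + √(1 - ‖p‖ ^ 2))) • p)

section Mobius

variable {p z : E}

lemma one_sub_inner_ne_zero (hp : ‖p‖ < 1) (hz : ‖z‖ < 1) : 1 - inner ℂ p z ≠ 0 := by
  intro h
  have hle := norm_inner_le_norm (𝕜 := ℂ) p z
  rw [(sub_eq_zero.1 h).symm, norm_one] at hle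
  exact absurd hle (mul_lt_one_of_nonneg_of_lt_one_left (norm_nonneg p) hp hz.le).not_ge

lemma inner_self_eq_one_sub_sqrt_sq (hp : ‖p‖ < 1) :
    (inner ℂ p p : ℂ) = 1 - (√(1 - ‖p‖ ^ 2) : ℂ) ^ 2 := by
  rw [inner_self_eq_norm_sq_to_K, ← Complex.ofReal_pow, Real.sq_sqrt (one_sub_norm_sq_pos hp).le]
  simp

lemma one_add_sqrt_ne_zero (x : ℝ) : (1 + √x : ℂ) ≠ 0 := by
  exact_mod_cast (by positivity : 1 + √x ≠ 0)

lemma norm_sq_mobius_numerator (hp : ‖p‖ < 1) (z : E) :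
    ‖p - (√(1 - ‖p‖ ^ 2) : ℂ) • z - (inner ℂ p z / (1 + √(1 - ‖p‖ ^ 2))) • p‖ ^ 2 =
      ‖1 - inner ℂ p z‖ ^ 2 - (1 - ‖p‖ ^ 2) * (1 - ‖z‖ ^ 2) := by
  have hpp := inner_self_eq_one_sub_sqrt_sq hp
  have hs1 := one_add_sqrt_ne_zero (1 - ‖p‖ ^ 2)
  have hzp : (inner ℂ z p : ℂ) = conj (inner ℂ p z) := (inner_conj_symm z p).symm
  have hself : ∀ v : E, (inner ℂ v v : ℂ) = (‖v‖ : ℂ) ^ 2 := fun v => inner_self_eq_norm_sq_to_K v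
  have hsq : ((1 - ‖p‖ ^ 2 : ℝ) : ℂ) = (√(1 - ‖p‖ ^ 2) : ℂ) ^ 2 := by
    rw [← Complex.ofReal_pow, Real.sq_sqrt (one_sub_norm_sq_pos hp).le]
  rw [← Complex.ofReal_inj, Complex.ofReal_sub, Complex.ofReal_mul, hsq]
  push_cast
  rw [← hself, ← Complex.conj_mul' (1 - _)]
  simp only [inner_sub_left, inner_sub_right, inner_smul_left, inner_smul_right, hpp, hzp,
    hself z, map_div₀, map_add, map_sub, map_one, Complex.conj_ofReal]
  field_simp
  ring

lemma one_sub_norm_sq_mobius (hp : ‖p‖ < 1) (hz : ‖z‖ < 1) :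
    (1 - ‖mobius p z‖ ^ 2) * ‖1 - inner ℂ p z‖ ^ 2 = (1 - ‖p‖ ^ 2) * (1 - ‖z‖ ^ 2) := by
  have hne : ‖1 - inner ℂ p z‖ ≠ 0 := norm_ne_zero_iff.2 (one_sub_inner_ne_zero hp hz)
  rw [mobius, norm_smul, norm_inv, mul_pow, norm_sq_mobius_numerator hp]
  field_simp
  ring

lemma norm_mobius_lt_one (hp : ‖p‖ < 1) (hz : ‖z‖ < 1) : ‖mobius p z‖ < 1 := by
  have hpos : 0 < (1 - ‖mobius p z‖ ^ 2) * ‖1 - inner ℂ p z‖ ^ 2 := by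
    rw [one_sub_norm_sq_mobius hp hz]
    exact mul_pos (one_sub_norm_sq_pos hp) (one_sub_norm_sq_pos hz)
  exact (sq_lt_one_iff₀ (norm_nonneg _)).1 (sub_pos.1 (pos_of_mul_pos_left hpos (by positivity)))

lemma mobius_zero (p : E) : mobius p 0 = p := by simp [mobius]

lemma inner_mobius (hp : ‖p‖ < 1) (hz : ‖z‖ < 1) :
    inner ℂ p (mobius p z) = 1 - (√(1 - ‖p‖ ^ 2) : ℂ) ^ 2 / (1 - inner ℂ p z) := by
  have hne := one_sub_inner_ne_zero hp hz
  have hs1 := one_add_sqrt_ne_zero (1 - ‖p‖ ^ 2)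
  simp only [mobius, inner_sub_right, inner_smul_right, inner_self_eq_one_sub_sqrt_sq hp]
  field_simp
  ring

lemma mobius_mobius (hp : ‖p‖ < 1) (hz : ‖z‖ < 1) : mobius p (mobius p z) = z := by
  have hne := one_sub_inner_ne_zero hp hz
  have hs0 : (√(1 - ‖p‖ ^ 2) : ℂ) ≠ 0 := by
    exact_mod_cast (Real.sqrt_pos.2 (one_sub_norm_sq_pos hp)).ne'
  have hs1 := one_add_sqrt_ne_zero (1 - ‖p‖ ^ 2)
  rw [mobius, inner_mobius hp hz, mobius, inv_smul_eq_iff₀]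
  · match_scalars <;> field_simp <;> ring
  · rw [sub_sub_cancel]
    exact div_ne_zero (pow_ne_zero 2 hs0) hne

lemma mobius_self (hp : ‖p‖ < 1) : mobius p p = 0 := by
  simpa only [mobius_zero] using mobius_mobius hp (z := 0) (by simp)

lemma differentiableOn_mobius (hp : ‖p‖ < 1) : DifferentiableOn ℂ (mobius p) (ball 0 1) := by
  intro z hz
  have hinner : DifferentiableAt ℂ (fun z : E => (inner ℂ p z : ℂ)) z :=
    (innerSL ℂ p).differentiableAt
  refine DifferentiableAt.differentiableWithinAt (.smul ?_ (.sub ?_ (.smul_const ?_ p)))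
  · exact (hinner.const_sub 1).inv (one_sub_inner_ne_zero hp (mem_ball_zero_iff.1 hz))
  · exact (differentiableAt_id.const_smul _).const_sub p
  · simp only [div_eq_mul_inv]
    exact hinner.mul_const _

lemma mapsTo_mobius (hp : ‖p‖ < 1) : MapsTo (mobius p) (ball 0 1) (ball 0 1) := fun z hz => by
  rw [mem_ball_zero_iff] at hz ⊢
  exact norm_mobius_lt_one hp hz

end Mobius

section SchwarzPick

variable {z w : E}

lemma exists_holomorphic_disc_through (hz : ‖z‖ < 1) (hw : ‖w‖ < 1) :
    ∃ γ : ℂ → E, DifferentiableOn ℂ γ (ball 0 1) ∧ MapsTo γ (ball 0 1) (ball 0 1) ∧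
      γ 0 = w ∧ γ ‖mobius w z‖ = z := by
  set v := mobius w z
  set u : E := (‖v‖ : ℂ)⁻¹ • v
  have hu : ‖u‖ ≤ 1 := by
    rw [norm_smul, norm_inv, Complex.norm_real, norm_norm]
    exact inv_mul_le_one
  have huv : (‖v‖ : ℂ) • u = v := by
    rcases eq_or_ne v 0 with hv | hv
    · simp [hv]
    · exact smul_inv_smul₀ (by exact_mod_cast norm_ne_zero_iff.2 hv) v
  have hline : MapsTo (fun l : ℂ => l • u) (ball 0 1) (ball 0 1) := fun l hl => by
    rw [mem_ball_zero_iff] at hl ⊢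
    rw [norm_smul]
    exact (mul_le_of_le_one_right (norm_nonneg _) hu).trans_lt hl
  exact ⟨fun l => mobius w (l • u), (differentiableOn_mobius hw).comp
    (differentiable_id.smul_const u).differentiableOn hline, (mapsTo_mobius hw).comp hline,
    by simp only [zero_smul, mobius_zero], by simp only [huv, v, mobius_mobius hw hz]⟩

lemma norm_mobius_le_norm {g : ℂ → F} (hg : DifferentiableOn ℂ g (ball 0 1))
    (hmaps : MapsTo g (ball 0 1) (ball 0 1)) {l : ℂ} (hl : ‖l‖ < 1) :
    ‖mobius (g 0) (g l)‖ ≤ ‖l‖ := by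
  have hg0 : ‖g 0‖ < 1 := mem_ball_zero_iff.1 (hmaps (mem_ball_self one_pos))
  exact Complex.norm_le_norm_of_mapsTo_ball ((differentiableOn_mobius hg0).comp hg hmaps)
    (((mapsTo_mobius hg0).comp hmaps).mono_right ball_subset_closedBall) (mobius_self hg0) hl

-- Holomorphy along discs is all that is available for the flow of a vector field.
theorem schwarz_pick {f : E → F}
    (hf : ∀ γ : ℂ → E, DifferentiableOn ℂ γ (ball 0 1) → MapsTo γ (ball 0 1) (ball 0 1) →
      DifferentiableOn ℂ (f ∘ γ) (ball 0 1))
    (hmaps : MapsTo f (ball 0 1) (ball 0 1)) (hz : ‖z‖ < 1) (hw : ‖w‖ < 1) :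
    ‖1 - inner ℂ (f w) (f z)‖ ^ 2 * ((1 - ‖z‖ ^ 2) * (1 - ‖w‖ ^ 2)) ≤
      ‖1 - inner ℂ w z‖ ^ 2 * ((1 - ‖f z‖ ^ 2) * (1 - ‖f w‖ ^ 2)) := by
  have hfz : ‖f z‖ < 1 := mem_ball_zero_iff.1 (hmaps (mem_ball_zero_iff.2 hz))
  have hfw : ‖f w‖ < 1 := mem_ball_zero_iff.1 (hmaps (mem_ball_zero_iff.2 hw))
  obtain ⟨γ, hγ, hγmaps, hγ0, hγz⟩ := exists_holomorphic_disc_through hz hw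
  have hle : ‖mobius (f w) (f z)‖ ≤ ‖mobius w z‖ := by
    simpa [hγ0, hγz] using norm_mobius_le_norm (hf γ hγ hγmaps) (hmaps.comp hγmaps)
      (l := ‖mobius w z‖) (by simpa using norm_mobius_lt_one hw hz)
  calc ‖1 - inner ℂ (f w) (f z)‖ ^ 2 * ((1 - ‖z‖ ^ 2) * (1 - ‖w‖ ^ 2))
      = (1 - ‖mobius w z‖ ^ 2) * (‖1 - inner ℂ w z‖ ^ 2 * ‖1 - inner ℂ (f w) (f z)‖ ^ 2) := by
        rw [mul_comm (1 - ‖z‖ ^ 2), ← one_sub_norm_sq_mobius hw hz]; ring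
    _ ≤ (1 - ‖mobius (f w) (f z)‖ ^ 2) *
          (‖1 - inner ℂ w z‖ ^ 2 * ‖1 - inner ℂ (f w) (f z)‖ ^ 2) := by gcongr
    _ = ‖1 - inner ℂ w z‖ ^ 2 * ((1 - ‖f z‖ ^ 2) * (1 - ‖f w‖ ^ 2)) := by
        rw [mul_comm (1 - ‖f z‖ ^ 2), ← one_sub_norm_sq_mobius hfw hfz]; ring

end SchwarzPick

section TwoPoint

lemma hasDerivWithinAt_norm_sq {x : ℝ → E} {x' : E} {s : Set ℝ} {t : ℝ}
    (hx : HasDerivWithinAt x x' s t) :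
    HasDerivWithinAt (fun t => ‖x t‖ ^ 2) (2 * (inner ℂ (x t) x').re) s t := by
  let : InnerProductSpace ℝ E := InnerProductSpace.complexToReal
  exact hx.norm_sq

lemma nonpos_of_hasDerivWithinAt_Ici {f : ℝ → ℝ} {f' a : ℝ} (hf : HasDerivWithinAt f f' (Ici a) a)
    (h : ∀ t, a ≤ t → f t ≤ f a) : f' ≤ 0 := by
  have hslope := hasDerivWithinAt_iff_tendsto_slope.1 hf
  rw [Ici_sdiff_left] at hslope
  refine le_of_tendsto hslope ?_
  filter_upwards [self_mem_nhdsWithin] with t (ht : a < t)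
  rw [slope_def_field]
  exact div_nonpos_of_nonpos_of_nonneg (sub_nonpos.2 (h t ht.le)) (sub_nonneg.2 ht.le)

lemma two_point_of_hasDerivWithinAt {x y : ℝ → E} {x' y' : E}
    (hx : HasDerivWithinAt x x' (Ici 0) 0) (hy : HasDerivWithinAt y y' (Ici 0) 0)
    (hx0 : ‖x 0‖ < 1) (hy0 : ‖y 0‖ < 1)
    (hpick : ∀ t, 0 ≤ t → ‖1 - inner ℂ (y t) (x t)‖ ^ 2 * ((1 - ‖x 0‖ ^ 2) * (1 - ‖y 0‖ ^ 2)) ≤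
      ‖1 - inner ℂ (y 0) (x 0)‖ ^ 2 * ((1 - ‖x t‖ ^ 2) * (1 - ‖y t‖ ^ 2))) :
    (inner ℂ (x 0) x').re / (1 - ‖x 0‖ ^ 2) + (inner ℂ (y 0) y').re / (1 - ‖y 0‖ ^ 2) ≤
      ((inner ℂ (y 0) x' + inner ℂ y' (x 0)) / (1 - inner ℂ (y 0) (x 0))).re := by
  have hderiv := ((hasDerivWithinAt_norm_sq ((hy.inner ℂ hx).const_sub 1)).mul_const
    ((1 - ‖x 0‖ ^ 2) * (1 - ‖y 0‖ ^ 2))).sub ((((hasDerivWithinAt_norm_sq hx).const_sub 1).mul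
      ((hasDerivWithinAt_norm_sq hy).const_sub 1)).const_mul (‖1 - inner ℂ (y 0) (x 0)‖ ^ 2))
  have hle := nonpos_of_hasDerivWithinAt_Ici hderiv fun t ht => by
    simp only [Pi.sub_apply, Pi.mul_apply]
    linarith [hpick t ht]
  have hx1 := one_sub_norm_sq_pos hx0
  have hy1 := one_sub_norm_sq_pos hy0
  have hden : 0 < ‖1 - inner ℂ (y 0) (x 0)‖ ^ 2 :=
    pow_pos (norm_pos_iff.2 (one_sub_inner_ne_zero hy0 hx0)) 2
  have hre : ((inner ℂ (y 0) x' + inner ℂ y' (x 0)) / (1 - inner ℂ (y 0) (x 0))).re =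
      -(inner ℂ (1 - inner ℂ (y 0) (x 0)) (-(inner ℂ (y 0) x' + inner ℂ y' (x 0))) : ℂ).re /
        ‖1 - inner ℂ (y 0) (x 0)‖ ^ 2 := by
    rw [Complex.div_re, ← Complex.normSq_eq_norm_sq, ← add_div]
    congr 1
    simp only [RCLike.inner_apply', Complex.mul_re, Complex.conj_re, Complex.conj_im,
      Complex.neg_re, Complex.neg_im]
    ring
  rw [hre, div_add_div _ _ hx1.ne' hy1.ne', div_le_div_iff₀ (mul_pos hx1 hy1) hden]
  nlinarith

-- Along any two trajectories the Schwarz–Pick inequality is an equality at time `0`.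
theorem two_point_inequality [CompleteSpace E] {G : E → E} (hG : DifferentiableOn ℂ G (ball 0 1))
    (hsol : ∀ z ∈ ball (0 : E) 1, ∃ x : ℝ → E, x 0 = z ∧ IsForwardTrajectory G (ball 0 1) x)
    {z w : E} (hz : ‖z‖ < 1) (hw : ‖w‖ < 1) :
    (inner ℂ z (G z)).re / (1 - ‖z‖ ^ 2) + (inner ℂ w (G w)).re / (1 - ‖w‖ ^ 2) ≤
      ((inner ℂ w (G z) + inner ℂ (G w) z) / (1 - inner ℂ w z)).re := by
  choose! X hX0 hX using hsol
  have hflow : ∀ t, 0 ≤ t → ∀ γ : ℂ → E, DifferentiableOn ℂ γ (ball 0 1) →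
      MapsTo γ (ball 0 1) (ball 0 1) →
      DifferentiableOn ℂ ((fun p => X p t) ∘ γ) (ball 0 1) := fun t ht γ hγ hγmaps s hs => by
    have hnhds : ∀ᶠ s in 𝓝 s, γ s ∈ ball (0 : E) 1 :=
      eventually_of_mem (isOpen_ball.mem_nhds hs) hγmaps
    refine (differentiableAt_trajectory isOpen_ball hG (hnhds.mono fun s hs => hX _ hs)
      ?_ ht).differentiableWithinAt
    exact (hγ.differentiableAt (isOpen_ball.mem_nhds hs)).congr_of_eventuallyEq
      (hnhds.mono fun s hs => hX0 _ hs)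
  have hzX := hX0 z (mem_ball_zero_iff.2 hz)
  have hwX := hX0 w (mem_ball_zero_iff.2 hw)
  have hz' := (hX z (mem_ball_zero_iff.2 hz) 0 le_rfl).2
  have hw' := (hX w (mem_ball_zero_iff.2 hw) 0 le_rfl).2
  have h := two_point_of_hasDerivWithinAt hz' hw' (by rwa [hzX]) (by rwa [hwX]) fun t ht => by
    rw [hzX, hwX]
    exact schwarz_pick (f := fun p => X p t) (hflow t ht) (fun p hp => (hX p hp t ht).1) hz hw
  rwa [hzX, hwX] at h

end TwoPoint

end HilbertBall

namespace HalfPlane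

open Metric Set ComplexConjugate HilbertBall

section Cayley

/-- The Cayley transform, which maps the right half-plane onto the unit disc. -/
def cayley (p : ℂ) : ℂ := (p - 1) / (p + 1)

variable {p q : ℂ}

lemma add_one_ne_zero_of_re_pos (hp : 0 < p.re) : p + 1 ≠ 0 := fun h => by
  have hre := congrArg Complex.re h
  simp only [Complex.add_re, Complex.one_re, Complex.zero_re] at hre
  linarith

lemma one_sub_norm_sq_cayley (hp : 0 < p.re) :
    1 - ‖cayley p‖ ^ 2 = 4 * p.re / ‖p + 1‖ ^ 2 := by
  have hne : ‖p + 1‖ ^ 2 ≠ 0 := pow_ne_zero 2 (norm_ne_zero_iff.2 (add_one_ne_zero_of_re_pos hp))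
  rw [cayley, norm_div, div_pow, eq_div_iff hne, sub_mul, div_mul_cancel₀ _ hne,
    ← Complex.normSq_eq_norm_sq, ← Complex.normSq_eq_norm_sq, Complex.normSq_apply,
    Complex.normSq_apply]
  simp only [Complex.add_re, Complex.sub_re, Complex.add_im, Complex.sub_im, Complex.one_re,
    Complex.one_im]
  ring

lemma norm_cayley_lt_one (hp : 0 < p.re) : ‖cayley p‖ < 1 := by
  have hpos : 0 < 1 - ‖cayley p‖ ^ 2 := by
    have hne := norm_pos_iff.2 (add_one_ne_zero_of_re_pos hp)
    rw [one_sub_norm_sq_cayley hp]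
    positivity
  exact (sq_lt_one_iff₀ (norm_nonneg _)).1 (sub_pos.1 hpos)

lemma one_sub_inner_cayley (hp : 0 < p.re) (hq : 0 < q.re) :
    1 - inner ℂ (cayley q) (cayley p) = 2 * (p + conj q) / ((p + 1) * conj (q + 1)) := by
  have hp1 := add_one_ne_zero_of_re_pos hp
  have hq1 : conj (q + 1) ≠ 0 := (map_ne_zero _).2 (add_one_ne_zero_of_re_pos hq)
  simp only [cayley, RCLike.inner_apply', map_div₀, map_sub, map_add, map_one] at hq1 ⊢
  field_simp
  ring

end Cayley

variable {Q : ℂ → ℂ} {z w : ℂ}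

theorem schwarz_pick_of_re_pos (hQ : DifferentiableOn ℂ Q (ball 0 1))
    (hre : ∀ z ∈ ball (0 : ℂ) 1, 0 < (Q z).re) (hz : ‖z‖ < 1) (hw : ‖w‖ < 1) :
    ‖Q z + conj (Q w)‖ ^ 2 * ((1 - ‖z‖ ^ 2) * (1 - ‖w‖ ^ 2)) ≤
      4 * (Q z).re * (Q w).re * ‖1 - conj w * z‖ ^ 2 := by
  have hQz := hre z (mem_ball_zero_iff.2 hz)
  have hQw := hre w (mem_ball_zero_iff.2 hw)
  have hcayley : DifferentiableOn ℂ (cayley ∘ Q) (ball 0 1) :=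
    (hQ.sub_const 1).div (hQ.add_const 1) fun z hz => add_one_ne_zero_of_re_pos (hre z hz)
  have hpick := schwarz_pick (f := cayley ∘ Q) (fun γ hγ hγmaps => hcayley.comp hγ hγmaps)
    (fun z hz => mem_ball_zero_iff.2 (norm_cayley_lt_one (hre z hz))) hz hw
  simp only [Function.comp_apply, one_sub_inner_cayley hQz hQw, one_sub_norm_sq_cayley hQz,
    one_sub_norm_sq_cayley hQw, norm_div, norm_mul, RCLike.norm_conj, Complex.norm_ofNat] at hpick
  have hz1 := norm_pos_iff.2 (add_one_ne_zero_of_re_pos hQz)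
  have hw1 := norm_pos_iff.2 (add_one_ne_zero_of_re_pos hQw)
  rw [RCLike.inner_apply'] at hpick
  field_simp at hpick ⊢
  linarith

theorem schwarz_pick_of_re_nonneg (hQ : DifferentiableOn ℂ Q (ball 0 1))
    (hre : ∀ z ∈ ball (0 : ℂ) 1, 0 ≤ (Q z).re) (hz : ‖z‖ < 1) (hw : ‖w‖ < 1) :
    ‖Q z + conj (Q w)‖ ^ 2 * ((1 - ‖z‖ ^ 2) * (1 - ‖w‖ ^ 2)) ≤
      4 * (Q z).re * (Q w).re * ‖1 - conj w * z‖ ^ 2 := by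
  have hpert : ∀ᶠ ε : ℝ in 𝓝[>] 0,
      ‖(Q z + ε) + conj (Q w + ε)‖ ^ 2 * ((1 - ‖z‖ ^ 2) * (1 - ‖w‖ ^ 2)) ≤
      4 * (Q z + ε).re * (Q w + ε).re * ‖1 - conj w * z‖ ^ 2 := by
    filter_upwards [self_mem_nhdsWithin] with ε hε
    refine schwarz_pick_of_re_pos (Q := fun z => Q z + ε) (hQ.add_const _) (fun z hz => ?_) hz hw
    exact add_pos_of_nonneg_of_pos (hre z hz) hε
  have hleft : Continuous fun ε : ℝ =>
      ‖(Q z + ε) + conj (Q w + ε)‖ ^ 2 * ((1 - ‖z‖ ^ 2) * (1 - ‖w‖ ^ 2)) := by fun_prop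
  have hright : Continuous fun ε : ℝ =>
      4 * (Q z + ε).re * (Q w + ε).re * ‖1 - conj w * z‖ ^ 2 := by fun_prop
  simpa using le_of_tendsto_of_tendsto ((hleft.tendsto 0).mono_left nhdsWithin_le_nhds)
    ((hright.tendsto 0).mono_left nhdsWithin_le_nhds) hpert

lemma norm_le_norm_add_conj (a b : ℂ) : ‖a‖ ≤ ‖a + conj b‖ + ‖b‖ := by
  simpa using norm_sub_le (a + conj b) (conj b)

lemma tendsto_one_sub_mul_norm (hQ : DifferentiableOn ℂ Q (ball 0 1))
    (hre : ∀ z ∈ ball (0 : ℂ) 1, 0 ≤ (Q z).re)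
    (hrad : Tendsto (fun r : ℝ => (1 - r) * (Q r).re) (𝓝[<] 1) (𝓝 0)) :
    Tendsto (fun r : ℝ => (1 - r) * ‖Q r‖) (𝓝[<] 1) (𝓝 0) := by
  have hlim : Tendsto (fun r : ℝ => √(4 * (Q 0).re * ((1 - r) * (Q r).re)) + (1 - r) * ‖Q 0‖)
      (𝓝[<] 1) (𝓝 0) := by
    have hcont : Continuous fun r : ℝ => 1 - r := by fun_prop
    have hone : Tendsto (fun r : ℝ => 1 - r) (𝓝[<] 1) (𝓝 0) :=
      Tendsto.mono_left (by simpa using hcont.tendsto 1) nhdsWithin_le_nhds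
    simpa using (hrad.const_mul (4 * (Q 0).re)).sqrt.add (hone.mul_const ‖Q 0‖)
  have hbound : ∀ᶠ r : ℝ in 𝓝[<] 1, 0 ≤ (1 - r) * ‖Q r‖ ∧
      (1 - r) * ‖Q r‖ ≤ √(4 * (Q 0).re * ((1 - r) * (Q r).re)) + (1 - r) * ‖Q 0‖ := by
    filter_upwards [Ioo_mem_nhdsLT zero_lt_one] with r ⟨hr0, hr1⟩
    have hr : 0 < 1 - r := sub_pos.2 hr1
    refine ⟨mul_nonneg hr.le (norm_nonneg _), ?_⟩
    have hpick := schwarz_pick_of_re_nonneg hQ hre (z := r) (w := 0)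
      (by simpa [abs_of_pos hr0] using hr1) (by simp)
    simp only [map_zero, zero_mul, sub_zero, norm_one, one_pow, mul_one, norm_zero, ne_eq,
      OfNat.ofNat_ne_zero, not_false_eq_true, zero_pow, Complex.norm_real, Real.norm_eq_abs,
      sq_abs] at hpick
    have hsqrt : (1 - r) * ‖Q r + conj (Q 0)‖ ≤ √(4 * (Q 0).re * ((1 - r) * (Q r).re)) := by
      refine Real.le_sqrt_of_sq_le ?_
      calc ((1 - r) * ‖Q r + conj (Q 0)‖) ^ 2
          = (1 - r) * (‖Q r + conj (Q 0)‖ ^ 2 * (1 - r)) := by ring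
        _ ≤ (1 - r) * (‖Q r + conj (Q 0)‖ ^ 2 * (1 - r ^ 2)) := by gcongr; nlinarith
        _ ≤ (1 - r) * (4 * (Q r).re * (Q 0).re) := by gcongr
        _ = 4 * (Q 0).re * ((1 - r) * (Q r).re) := by ring
    nlinarith [norm_le_norm_add_conj (Q r) (Q 0)]
  exact squeeze_zero' (hbound.mono fun _ h => h.1) (hbound.mono fun _ h => h.2) hlim

lemma half_le_of_nontangential {C : ℝ} (hz : ‖z‖ < 1) (hC : ‖z - 1‖ ≤ C * (1 - ‖z‖ ^ 2)) :
    1 / 2 ≤ C := by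
  have hle : 1 - ‖z‖ ≤ ‖z - 1‖ := by simpa [norm_sub_rev] using norm_sub_norm_le (1 : ℂ) z
  nlinarith [one_sub_norm_sq_pos hz]

lemma norm_one_sub_norm_mul_le {C : ℝ} (hz : ‖z‖ < 1) (hC : ‖z - 1‖ ≤ C * (1 - ‖z‖ ^ 2)) :
    ‖1 - (‖z‖ : ℂ) * z‖ ≤ (C + 1) * (1 - ‖z‖ ^ 2) := by
  have hsplit : 1 - (‖z‖ : ℂ) * z = -(z - 1) + ((1 - ‖z‖ : ℝ) : ℂ) * z := by push_cast; ring
  calc ‖1 - (‖z‖ : ℂ) * z‖ ≤ ‖z - 1‖ + (1 - ‖z‖) * ‖z‖ := by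
        rw [hsplit]
        refine (norm_add_le _ _).trans_eq ?_
        rw [norm_neg, norm_mul, Complex.norm_real, Real.norm_of_nonneg (sub_nonneg.2 hz.le)]
    _ ≤ (C + 1) * (1 - ‖z‖ ^ 2) := by nlinarith [norm_nonneg z]

lemma norm_le_mul_norm_of_nontangential (hQ : DifferentiableOn ℂ Q (ball 0 1))
    (hre : ∀ z ∈ ball (0 : ℂ) 1, 0 ≤ (Q z).re) {C : ℝ} (hz : ‖z‖ < 1)
    (hC : ‖z - 1‖ ≤ C * (1 - ‖z‖ ^ 2)) :
    ‖Q z‖ ≤ (4 * (C + 1) ^ 2 + 1) * ‖Q ‖z‖‖ := by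
  have hr : ‖(‖z‖ : ℂ)‖ < 1 := by simpa using hz
  have hd := one_sub_norm_sq_pos hz
  have hpick := schwarz_pick_of_re_nonneg hQ hre hz hr
  simp only [Complex.norm_real, norm_norm, Complex.conj_ofReal] at hpick
  set S := ‖Q z + conj (Q ‖z‖)‖
  have hQr := hre ‖z‖ (mem_ball_zero_iff.2 hr)
  have hreS : (Q z).re ≤ S := by
    have hle := Complex.re_le_norm (Q z + conj (Q ‖z‖))
    rw [Complex.add_re, Complex.conj_re] at hle
    linarith
  have hS : S ≤ 4 * (C + 1) ^ 2 * (Q ‖z‖).re := by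
    rcases (norm_nonneg (Q z + conj (Q ‖z‖))).eq_or_lt with h0 | hpos
    · exact h0.symm.trans_le (by positivity)
    refine le_of_mul_le_mul_left ?_ (mul_pos hpos (pow_pos hd 2))
    calc S * (1 - ‖z‖ ^ 2) ^ 2 * S = S ^ 2 * ((1 - ‖z‖ ^ 2) * (1 - ‖z‖ ^ 2)) := by ring
      _ ≤ 4 * (Q z).re * (Q ‖z‖).re * ‖1 - (‖z‖ : ℂ) * z‖ ^ 2 := hpick
      _ ≤ 4 * S * (Q ‖z‖).re * ((C + 1) * (1 - ‖z‖ ^ 2)) ^ 2 := by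
          gcongr
          exact norm_one_sub_norm_mul_le hz hC
      _ = S * (1 - ‖z‖ ^ 2) ^ 2 * (4 * (C + 1) ^ 2 * (Q ‖z‖).re) := by ring
  have hre_le : 4 * (C + 1) ^ 2 * (Q ‖z‖).re ≤ 4 * (C + 1) ^ 2 * ‖Q ‖z‖‖ := by
    gcongr
    exact Complex.re_le_norm _
  linarith [norm_le_norm_add_conj (Q z) (Q ‖z‖)]

theorem tendsto_one_sub_mul_of_re_nonneg (hQ : DifferentiableOn ℂ Q (ball 0 1))
    (hre : ∀ z ∈ ball (0 : ℂ) 1, 0 ≤ (Q z).re)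
    (hrad : Tendsto (fun r : ℝ => (1 - r) * (Q r).re) (𝓝[<] 1) (𝓝 0))
    {ι : Type*} {l : Filter ι} {ζ : ι → ℂ} (hlim : Tendsto ζ l (𝓝 1)) {C : ℝ}
    (hζ : ∀ᶠ k in l, ‖ζ k‖ < 1 ∧ ‖ζ k - 1‖ ≤ C * (1 - ‖ζ k‖ ^ 2)) :
    Tendsto (fun k => (1 - ζ k) * Q (ζ k)) l (𝓝 0) := by
  have hr : Tendsto (fun k => ‖ζ k‖) l (𝓝[<] 1) :=
    tendsto_nhdsWithin_iff.2 ⟨by simpa using hlim.norm, hζ.mono fun _ h => h.1⟩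
  have hbound := ((tendsto_one_sub_mul_norm hQ hre hrad).comp hr).const_mul
    (2 * C * (4 * (C + 1) ^ 2 + 1))
  rw [mul_zero] at hbound
  refine squeeze_zero_norm' (hζ.mono fun k ⟨hk, hC⟩ => ?_) hbound
  have hC0 : 0 ≤ C := by linarith [half_le_of_nontangential hk hC]
  have hone : ‖1 - ζ k‖ ≤ 2 * C * (1 - ‖ζ k‖) := by
    rw [norm_sub_rev]
    nlinarith [hC, mul_nonneg hC0 (sq_nonneg (1 - ‖ζ k‖))]
  calc ‖(1 - ζ k) * Q (ζ k)‖ = ‖1 - ζ k‖ * ‖Q (ζ k)‖ := norm_mul _ _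
    _ ≤ (2 * C * (1 - ‖ζ k‖)) * ((4 * (C + 1) ^ 2 + 1) * ‖Q ‖ζ k‖‖) :=
        mul_le_mul hone (norm_le_mul_norm_of_nontangential hQ hre hk hC) (norm_nonneg _)
          ((norm_nonneg _).trans hone)
    _ = 2 * C * (4 * (C + 1) ^ 2 + 1) * ((1 - ‖ζ k‖) * ‖Q ‖ζ k‖‖) := by ring

end HalfPlane

section CauchyEstimate

open Metric

variable {E F : Type*} [NormedAddCommGroup E] [NormedSpace ℂ E] [NormedAddCommGroup F]
  [NormedSpace ℂ F]

lemma exists_norm_fderiv_mul_le {f : E → F} {U : Set E} (hU : IsOpen U)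
    (hf : DifferentiableOn ℂ f U) {z v : E} {ρ : ℝ} (hρ : 0 < ρ)
    (hmem : ∀ l : ℂ, ‖l‖ ≤ ρ → z + l • v ∈ U) :
    ∃ l : ℂ, ‖l‖ = ρ ∧ ‖fderiv ℂ f z v‖ * ρ ≤ ‖f (z + l • v)‖ := by
  have hline (a : ℂ) : HasDerivAt (fun l : ℂ => z + l • v) v a := by
    simpa using ((hasDerivAt_id a).smul_const v).const_add z
  have hdiff : DifferentiableOn ℂ (fun l : ℂ => f (z + l • v)) (closedBall 0 ρ) :=
    hf.comp (fun l _ => (hline l).differentiableAt.differentiableWithinAt)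
      fun l hl => hmem l (mem_closedBall_zero_iff.1 hl)
  have hz : z ∈ U := by simpa using hmem 0 (by simpa using hρ.le)
  have hderiv : deriv (fun l : ℂ => f (z + l • v)) 0 = fderiv ℂ f z v :=
    ((hf.differentiableAt (hU.mem_nhds hz)).hasFDerivAt.comp_hasDerivAt_of_eq (0 : ℂ) (hline 0)
      (by simp)).deriv
  obtain ⟨l, hl, hmax⟩ := (isCompact_sphere (0 : ℂ) ρ).exists_isMaxOn
    (NormedSpace.sphere_nonempty.2 hρ.le) (hdiff.continuousOn.norm.mono sphere_subset_closedBall)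
  refine ⟨l, mem_sphere_zero_iff_norm.1 hl, ?_⟩
  rw [← hderiv, ← le_div_iff₀ hρ]
  exact Complex.norm_deriv_le_of_forall_mem_sphere_norm_le hρ (hdiff.diffContOnCl_ball le_rfl)
    fun l hl => hmax hl

end CauchyEstimate

namespace UnitBall

open Set ComplexConjugate HilbertBall HalfPlane

section Coordinates

variable {n : ℕ}

lemma mem_ball_iff {z : Cn n} : z ∈ ball n ↔ ‖z‖ < 1 := mem_ball_zero_iff

lemma isOpen_ball : IsOpen (ball n) := Metric.isOpen_ball

lemma e_apply (i j : Fin n) : (e i : Cn n) j = if j = i then 1 else 0 := by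
  simp [e]

lemma norm_e (j : Fin n) : ‖(e j : Cn n)‖ = 1 := by simp [e]

lemma inner_e (j : Fin n) (z : Cn n) : inner ℂ (e j : Cn n) z = z j := by
  simp [e, EuclideanSpace.inner_single_left]

lemma norm_smul_e (a : ℂ) (j : Fin n) : ‖a • (e j : Cn n)‖ = ‖a‖ := by
  rw [norm_smul, norm_e, mul_one]

lemma smul_e_mem_ball {a : ℂ} (ha : ‖a‖ < 1) (j : Fin n) : a • (e j : Cn n) ∈ ball n :=
  mem_ball_iff.2 (by rwa [norm_smul_e])

lemma smul_e_apply_self (a : ℂ) (j : Fin n) : (a • (e j : Cn n)) j = a := by simp [e_apply]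

lemma hasFDerivAt_apply (j : Fin n) (z : Cn n) :
    HasFDerivAt (fun w : Cn n => w j) (EuclideanSpace.proj (𝕜 := ℂ) j : Cn n →L[ℂ] ℂ) z :=
  (EuclideanSpace.proj (𝕜 := ℂ) j).hasFDerivAt

end Coordinates

section Components

variable {n : ℕ} {G : Cn n → Cn n}

lemma differentiableOn_apply (hG : DifferentiableOn ℂ G (ball n)) (k : Fin n) :
    DifferentiableOn ℂ (fun z => G z k) (ball n) := fun z hz =>
  (hasFDerivAt_apply k (G z)).differentiableAt.comp_differentiableWithinAt z (hG z hz)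

lemma fderiv_apply_eq (hG : DifferentiableOn ℂ G (ball n)) {z : Cn n} (hz : z ∈ ball n)
    (v : Cn n) (k : Fin n) : fderiv ℂ (fun z => G z k) z v = fderiv ℂ G z v k := by
  have hGz := (hG.differentiableAt (isOpen_ball.mem_nhds hz)).hasFDerivAt
  exact DFunLike.congr_fun ((hasFDerivAt_apply k (G z)).comp z hGz).fderiv v

lemma norm_add_smul_e_sq_le (z : Cn n) (l : ℂ) (j : Fin n) :
    ‖z + l • (e j : Cn n)‖ ^ 2 ≤ ‖z‖ ^ 2 + 2 * (‖l‖ * ‖z j‖) + ‖l‖ ^ 2 := by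
  have hinner : RCLike.re (inner ℂ z (l • (e j : Cn n))) ≤ ‖l‖ * ‖z j‖ := by
    refine (RCLike.re_le_norm _).trans_eq ?_
    rw [inner_smul_right, norm_mul, norm_inner_symm, inner_e]
  rw [norm_add_sq (𝕜 := ℂ), norm_smul_e]
  linarith

end Components

variable {n : ℕ} [NeZero n]

lemma one_sub_apply_ne_zero {z : Cn n} (hz : z ∈ ball n) : 1 - z 0 ≠ 0 := by
  have hle := (PiLp.norm_apply_le z 0).trans_lt (mem_ball_iff.1 hz)
  intro h
  rw [← sub_eq_zero.1 h, norm_one] at hle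
  exact lt_irrefl _ hle

section PoissonKernel

lemma poissonKernel_neg {z : Cn n} (hz : z ∈ ball n) : poissonKernel z < 0 := by
  have hz0 := norm_pos_iff.2 (one_sub_apply_ne_zero hz)
  exact neg_lt_zero.2 (div_pos (one_sub_norm_sq_pos (mem_ball_iff.1 hz)) (pow_pos hz0 2))

lemma differentiableAt_poissonKernel {z : Cn n} (hz : z ∈ ball n) :
    DifferentiableAt ℝ (poissonKernel (n := n)) z := by
  have hcoord (j : Fin n) : DifferentiableAt ℝ (fun w : Cn n => w j) z :=
    (hasFDerivAt_apply j z).differentiableAt.restrictScalars ℝ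
  have hnum : DifferentiableAt ℝ (fun w : Cn n => 1 - ‖w‖ ^ 2) z := by
    simp only [EuclideanSpace.norm_sq_eq]
    exact (DifferentiableAt.fun_sum fun j _ => (hcoord j).norm_sq ℝ).const_sub 1
  have hden : DifferentiableAt ℝ (fun w : Cn n => ‖1 - w 0‖ ^ 2) z :=
    ((hcoord 0).const_sub 1).norm_sq ℝ
  have hne := pow_ne_zero 2 (norm_ne_zero_iff.2 (one_sub_apply_ne_zero hz))
  unfold poissonKernel
  simp only [div_eq_mul_inv]
  exact (hnum.mul (hden.inv hne)).neg

lemma re_inner_eq_re_div_mul {w : ℂ} (hw : w ≠ 0) (v : ℂ) :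
    (inner ℂ w v).re = (v / w).re * ‖w‖ ^ 2 := by
  have hmul : inner ℂ w v = v / w * ((‖w‖ ^ 2 : ℝ) : ℂ) := by
    rw [RCLike.inner_apply, Complex.ofReal_pow, ← Complex.mul_conj']
    field_simp
  rw [hmul, Complex.re_mul_ofReal]

lemma hasLineDerivAt_poissonKernel {z : Cn n} (hz : z ∈ ball n) (v : Cn n) :
    HasLineDerivAt ℝ (poissonKernel (n := n)) (poissonKernel z *
      (2 * ((v 0 / (1 - z 0)).re - (inner ℂ z v).re / (1 - ‖z‖ ^ 2)))) z v := by
  have hz0 := one_sub_apply_ne_zero hz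
  have hline : HasDerivAt (fun t : ℝ => z + t • v) v 0 := by
    simpa using ((hasDerivAt_id (0 : ℝ)).smul_const v).const_add z
  have hcoord : HasDerivAt (fun t : ℝ => 1 - (z + t • v) 0) (-v 0) 0 :=
    (((hasFDerivAt_apply 0 _).restrictScalars ℝ).comp_hasDerivAt (0 : ℝ) hline).const_sub (1 : ℂ)
  have hnum := (hasDerivWithinAt_norm_sq hline.hasDerivWithinAt).hasDerivAt univ_mem
  have hden := (hasDerivWithinAt_norm_sq hcoord.hasDerivWithinAt).hasDerivAt univ_mem
  have hz0' : ‖1 - z 0‖ ≠ 0 := norm_ne_zero_iff.2 hz0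
  have hd := (one_sub_norm_sq_pos (mem_ball_iff.1 hz)).ne'
  refine ((hnum.const_sub 1).div hden (by simpa using hz0')).neg.congr_deriv ?_
  simp only [zero_smul, add_zero, inner_neg_right, Complex.neg_re, re_inner_eq_re_div_mul hz0,
    poissonKernel]
  field_simp
  ring

/-- Minus the logarithmic derivative of the Poisson kernel along `G`; the dilation of `G` is its
supremum over the ball. -/
def rate (G : Cn n → Cn n) (z : Cn n) : ℝ :=
  2 * ((inner ℂ z (G z)).re / (1 - ‖z‖ ^ 2) - (G z 0 / (1 - z 0)).re)

variable {G : Cn n → Cn n}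

lemma fderiv_poissonKernel_div {z : Cn n} (hz : z ∈ ball n) :
    fderiv ℝ (poissonKernel (n := n)) z (G z) / poissonKernel z = -rate G z := by
  rw [← (differentiableAt_poissonKernel hz).lineDeriv_eq_fderiv,
    (hasLineDerivAt_poissonKernel hz _).lineDeriv, mul_div_cancel_left₀ _ (poissonKernel_neg hz).ne,
    rate]
  ring

lemma isBRNP_of_bddAbove_rate (h : BddAbove (rate G '' ball n)) : IsBRNP G := by
  obtain ⟨b, hb⟩ := h
  refine ⟨b, fun z hz => ?_⟩
  have hneg := poissonKernel_neg hz
  rw [(div_eq_iff hneg.ne).1 (fderiv_poissonKernel_div hz)]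
  nlinarith [hb (mem_image_of_mem _ hz)]

lemma dilation_eq_sSup_rate : dilation G = sSup (rate G '' ball n) := by
  rw [dilation, image_congr fun z hz => fderiv_poissonKernel_div (G := G) hz,
    ← neg_neg (sSup _), ← Real.sInf_neg, ← image_neg_eq_neg, image_image]

lemma isLUB_dilation (h : BddAbove (rate G '' ball n)) :
    IsLUB (rate G '' ball n) (dilation G) := by
  rw [dilation_eq_sSup_rate]
  exact isLUB_csSup (Nonempty.image _ ⟨0, by simp [mem_ball_iff]⟩) h

end PoissonKernel

section KoranyiBigO

variable {F : Type*} [NormedAddCommGroup F] {f : Cn n → F} {a R : ℝ} {z : Cn n}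

/-- `f = O(|1 - z₁| ^ a)` in every Korányi region of vertex `e₁`. -/
def IsKoranyiBigO (a : ℝ) (f : Cn n → F) : Prop :=
  ∀ R : ℝ, 1 ≤ R → ∃ C : ℝ, ∀ z ∈ koranyi n R, ‖f z‖ ≤ C * ‖1 - z 0‖ ^ a

lemma norm_one_sub_apply_pos (hz : z ∈ koranyi n R) : 0 < ‖1 - z 0‖ :=
  norm_pos_iff.2 (one_sub_apply_ne_zero hz.1)

lemma boundedInKoranyi_norm_div_rpow_iff :
    BoundedInKoranyi (fun z => ‖f z‖ / ‖z 0 - 1‖ ^ a) ↔ IsKoranyiBigO a f := by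
  refine forall₂_congr fun R _ => exists_congr fun C => forall₂_congr fun z hz => ?_
  have hpos := Real.rpow_pos_of_pos (norm_one_sub_apply_pos hz) a
  change ‖‖f z‖ / ‖z 0 - 1‖ ^ a‖ ≤ C ↔ _
  rw [norm_sub_rev (z 0) 1, norm_div, norm_norm, Real.norm_of_nonneg hpos.le, div_le_iff₀ hpos]

lemma IsKoranyiBigO.boundedInKoranyi (hf : IsKoranyiBigO 0 f) : BoundedInKoranyi f := by
  simpa only [IsKoranyiBigO, BoundedInKoranyi, Real.rpow_zero, mul_one] using hf

lemma IsKoranyiBigO.tendsto_zero (hf : IsKoranyiBigO a f) (ha : 0 < a) (hR : 1 ≤ R)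
    {ι : Type*} {l : Filter ι} {z : ι → Cn n} (hz : ∀ᶠ k in l, z k ∈ koranyi n R)
    (hlim : Tendsto (fun k => z k 0) l (𝓝 1)) : Tendsto (fun k => f (z k)) l (𝓝 0) := by
  obtain ⟨C, hC⟩ := hf R hR
  have hbound : Tendsto (fun k => C * ‖1 - z k 0‖ ^ a) l (𝓝 0) := by
    simpa [Real.zero_rpow ha.ne'] using
      (((hlim.const_sub 1).norm.rpow_const (Or.inr ha.le)).const_mul C)
  exact squeeze_zero_norm' (hz.mono fun k hk => hC _ hk) hbound

end KoranyiBigO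

section NormalQuotient

/-- The normal component of `G` divided by `z₁ - 1`. -/
def normalQuotient (G : Cn n → Cn n) (z : Cn n) : ℂ := G z 0 / (z 0 - 1)

variable {G : Cn n → Cn n}

lemma apply_sub_one_ne_zero {z : Cn n} (hz : z ∈ ball n) : z 0 - 1 ≠ 0 :=
  sub_ne_zero.2 (sub_ne_zero.1 (one_sub_apply_ne_zero hz)).symm

lemma differentiableOn_normalQuotient (hG : DifferentiableOn ℂ G (ball n)) :
    DifferentiableOn ℂ (normalQuotient G) (ball n) := by
  have hcoord : Differentiable ℂ fun w : Cn n => w 0 :=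
    fun w => (hasFDerivAt_apply 0 w).differentiableAt
  unfold normalQuotient
  simp only [div_eq_mul_inv]
  exact (hcoord.comp_differentiableOn hG).mul
    ((hcoord.sub_const 1).differentiableOn.inv fun z hz => apply_sub_one_ne_zero hz)

end NormalQuotient

section Radial

variable {G : Cn n → Cn n}

lemma radius_mem_koranyi {r : ℝ} (hr : r ∈ Ioo (0 : ℝ) 1) :
    (r : ℂ) • (e 0 : Cn n) ∈ koranyi n 2 := by
  have hnorm : ‖(r : ℂ)‖ = r := by rw [Complex.norm_real, Real.norm_of_nonneg hr.1.le]
  have hnorm' : ‖(1 - r : ℂ)‖ = 1 - r := by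
    rw [← Complex.ofReal_one, ← Complex.ofReal_sub, Complex.norm_real,
      Real.norm_of_nonneg (sub_nonneg.2 hr.2.le)]
  refine ⟨smul_e_mem_ball (hnorm.trans_lt hr.2) 0, ?_⟩
  rw [smul_e_apply_self, norm_smul_e, hnorm, hnorm']
  nlinarith [hr.1, hr.2]

lemma tendsto_radius :
    Tendsto (fun r : ℝ => ((r : ℂ) • (e 0 : Cn n)) 0) (𝓝[<] 1) (𝓝 1) := by
  simp only [smul_e_apply_self]
  exact (Complex.continuous_ofReal.tendsto 1).mono_left nhdsWithin_le_nhds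

lemma eventually_radius_mem_koranyi :
    ∀ᶠ r : ℝ in 𝓝[<] 1, (r : ℂ) • (e 0 : Cn n) ∈ koranyi n 2 :=
  mem_of_superset (Ioo_mem_nhdsLT one_pos) fun _ => radius_mem_koranyi

lemma two_point_inequality_radius (hG : IsInfinitesimalGenerator G) {z : Cn n} (hz : z ∈ ball n)
    {r : ℝ} (hr : r ∈ Ioo (0 : ℝ) 1) :
    (1 + r) / r * ((inner ℂ z (G z)).re / (1 - ‖z‖ ^ 2) -
      ((r * G z 0 + inner ℂ (G ((r : ℂ) • (e 0 : Cn n))) z) / (1 - r * z 0)).re) ≤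
      (normalQuotient G ((r : ℂ) • (e 0 : Cn n))).re := by
  obtain ⟨hr0, hr1⟩ := hr
  have hnorm : ‖(r : ℂ)‖ = r := by rw [Complex.norm_real, Real.norm_of_nonneg hr0.le]
  have htwo := two_point_inequality hG.1 hG.2 (mem_ball_iff.1 hz)
    (w := (r : ℂ) • (e 0 : Cn n)) (by rwa [norm_smul_e, hnorm])
  simp only [norm_smul_e, hnorm, inner_smul_left, inner_e, Complex.conj_ofReal] at htwo
  have hradius : ((r : ℂ) * G ((r : ℂ) • (e 0 : Cn n)) 0).re / (1 - r ^ 2) =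
      -(r / (1 + r) * (normalQuotient G ((r : ℂ) • (e 0 : Cn n))).re) := by
    rw [normalQuotient, smul_e_apply_self, ← Complex.ofReal_one, ← Complex.ofReal_sub,
      Complex.div_ofReal_re, Complex.re_ofReal_mul]
    have h1 : r - 1 ≠ 0 := (sub_neg.2 hr1).ne
    have h2 : 1 - r ^ 2 ≠ 0 := by nlinarith
    field_simp
    ring
  rw [hradius] at htwo
  calc _ ≤ (1 + r) / r * (r / (1 + r) * (normalQuotient G ((r : ℂ) • (e 0 : Cn n))).re) := by
        gcongr
        linarith
    _ = (normalQuotient G ((r : ℂ) • (e 0 : Cn n))).re := by field_simp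

lemma tendsto_two_point_inequality_radius
    (hlim : Tendsto (fun r : ℝ => G ((r : ℂ) • (e 0 : Cn n))) (𝓝[<] 1) (𝓝 0))
    {z : Cn n} (hz : z ∈ ball n) :
    Tendsto (fun r : ℝ => (1 + r) / r * ((inner ℂ z (G z)).re / (1 - ‖z‖ ^ 2) -
      ((r * G z 0 + inner ℂ (G ((r : ℂ) • (e 0 : Cn n))) z) / (1 - r * z 0)).re))
      (𝓝[<] 1) (𝓝 (rate G z)) := by
  have hr : Tendsto (fun r : ℝ => r) (𝓝[<] 1) (𝓝 1) := tendsto_id.mono_left nhdsWithin_le_nhds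
  have hrc : Tendsto (fun r : ℝ => (r : ℂ)) (𝓝[<] 1) (𝓝 1) :=
    (Complex.continuous_ofReal.tendsto 1).comp hr
  have hinner := (hlim.inner (𝕜 := ℂ) (tendsto_const_nhds (x := z)))
  have hquot := ((hrc.mul_const (G z 0)).add hinner).div ((hrc.mul_const (z 0)).const_sub 1)
    (by simpa using one_sub_apply_ne_zero hz)
  have hfactor : Tendsto (fun r : ℝ => (1 + r) / r) (𝓝[<] 1) (𝓝 2) := by
    have hdiv := (hr.const_add 1).div hr one_ne_zero
    rwa [one_add_one_eq_two, div_one] at hdiv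
  simpa [rate] using hfactor.mul (((Complex.continuous_re.tendsto _).comp hquot).const_sub
    ((inner ℂ z (G z)).re / (1 - ‖z‖ ^ 2)))

lemma eventually_lt_re_normalQuotient (hG : IsInfinitesimalGenerator G)
    (hlim : Tendsto (fun r : ℝ => G ((r : ℂ) • (e 0 : Cn n))) (𝓝[<] 1) (𝓝 0))
    {z : Cn n} (hz : z ∈ ball n) {c : ℝ} (hc : c < rate G z) :
    ∀ᶠ r : ℝ in 𝓝[<] 1, c < (normalQuotient G ((r : ℂ) • (e 0 : Cn n))).re := by
  filter_upwards [(tendsto_two_point_inequality_radius hlim hz).eventually (lt_mem_nhds hc),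
    Ioo_mem_nhdsLT one_pos] with r hlt hr
  exact hlt.trans_le (two_point_inequality_radius hG hz hr)

lemma bddAbove_rate (hG : IsInfinitesimalGenerator G)
    (hlim : Tendsto (fun r : ℝ => G ((r : ℂ) • (e 0 : Cn n))) (𝓝[<] 1) (𝓝 0)) {C : ℝ}
    (hC : ∀ᶠ r : ℝ in 𝓝[<] 1, (normalQuotient G ((r : ℂ) • (e 0 : Cn n))).re ≤ C) :
    BddAbove (rate G '' ball n) := by
  refine ⟨C, forall_mem_image.2 fun z hz => le_of_not_gt fun hlt => ?_⟩
  obtain ⟨r, hle, hgt⟩ := (hC.and (eventually_lt_re_normalQuotient hG hlim hz hlt)).exists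
  exact hle.not_gt hgt

end Radial

section Slice

variable {G : Cn n → Cn n} {ζ : ℂ}

lemma one_sub_ne_zero_of_norm_lt_one (hζ : ‖ζ‖ < 1) : 1 - ζ ≠ 0 :=
  sub_ne_zero.2 fun h => by simp [← h] at hζ

lemma re_one_add_div_one_sub (ζ : ℂ) :
    ((1 + ζ) / (1 - ζ)).re = (1 - ‖ζ‖ ^ 2) / ‖1 - ζ‖ ^ 2 := by
  rw [Complex.div_re, ← add_div, ← Complex.normSq_eq_norm_sq, ← Complex.normSq_eq_norm_sq,
    Complex.normSq_apply ζ]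
  congr 1
  simp only [Complex.add_re, Complex.sub_re, Complex.add_im, Complex.sub_im, Complex.one_re,
    Complex.one_im]
  ring

lemma rate_smul_e_mul (hζ : ‖ζ‖ < 1) :
    rate G (ζ • e 0) * ((1 - ‖ζ‖ ^ 2) / ‖1 - ζ‖ ^ 2) =
      2 * (normalQuotient G (ζ • e 0) / (1 - ζ)).re := by
  have hne := one_sub_ne_zero_of_norm_lt_one hζ
  have hne' : ζ - 1 ≠ 0 := sub_ne_zero.2 (sub_ne_zero.1 hne).symm
  have hcne : 1 - conj ζ ≠ 0 := by simpa using (map_ne_zero (starRingEnd ℂ)).2 hne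
  have hden : ((‖1 - ζ‖ ^ 2 : ℝ) : ℂ) = (1 - ζ) * (1 - conj ζ) := by
    rw [Complex.ofReal_pow, ← Complex.mul_conj', map_sub, map_one]
  have hnum : ((1 - ‖ζ‖ ^ 2 : ℝ) : ℂ) = 1 - conj ζ * ζ := by
    rw [Complex.ofReal_sub, Complex.ofReal_pow, ← Complex.conj_mul', Complex.ofReal_one]
  have hnum0 : 1 - conj ζ * ζ ≠ 0 := by
    rw [← hnum]
    exact_mod_cast (one_sub_norm_sq_pos hζ).ne'
  have hcomplex : (conj ζ * G (ζ • e 0) 0 / ((1 - ‖ζ‖ ^ 2 : ℝ) : ℂ) - G (ζ • e 0) 0 / (1 - ζ)) *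
      (((1 - ‖ζ‖ ^ 2) / ‖1 - ζ‖ ^ 2 : ℝ) : ℂ) = normalQuotient G (ζ • e 0) / (1 - ζ) := by
    rw [normalQuotient, smul_e_apply_self, Complex.ofReal_div, hden, hnum]
    field_simp
    ring
  rw [← hcomplex, Complex.re_mul_ofReal, Complex.sub_re, Complex.div_ofReal_re, rate, norm_smul_e,
    smul_e_apply_self, inner_smul_left, inner_e, mul_assoc]

lemma rate_radius {r : ℝ} (hr : r ∈ Ioo (0 : ℝ) 1) :
    rate G ((r : ℂ) • e 0) * (1 + r) = 2 * (normalQuotient G ((r : ℂ) • e 0)).re := by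
  obtain ⟨hr0, hr1⟩ := hr
  have hnorm : ‖(r : ℂ)‖ = r := by rw [Complex.norm_real, Real.norm_of_nonneg hr0.le]
  have hslice := rate_smul_e_mul (G := G) (hnorm.trans_lt hr1)
  have hpos : 0 < 1 - r := sub_pos.2 hr1
  rw [← Complex.ofReal_one, ← Complex.ofReal_sub, Complex.div_ofReal_re, hnorm, Complex.norm_real,
    Real.norm_of_nonneg hpos.le] at hslice
  field_simp at hslice
  nlinarith

lemma tendsto_re_normalQuotient_radius (hG : IsInfinitesimalGenerator G)
    (hlim : Tendsto (fun r : ℝ => G ((r : ℂ) • (e 0 : Cn n))) (𝓝[<] 1) (𝓝 0)) {β : ℝ}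
    (hβ : IsLUB (rate G '' ball n) β) :
    Tendsto (fun r : ℝ => (normalQuotient G ((r : ℂ) • (e 0 : Cn n))).re) (𝓝[<] 1) (𝓝 β) := by
  have hupper : Tendsto (fun r : ℝ => β * (1 + r) / 2) (𝓝[<] 1) (𝓝 β) := by
    have hcont : Continuous fun r : ℝ => β * (1 + r) / 2 := by fun_prop
    exact Tendsto.mono_left (by simpa [one_add_one_eq_two] using hcont.tendsto 1)
      nhdsWithin_le_nhds
  refine tendsto_order.2 ⟨fun c hc => ?_, fun c hc => ?_⟩
  · obtain ⟨_, ⟨z, hz, rfl⟩, hcz⟩ := (lt_isLUB_iff hβ).1 hc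
    exact eventually_lt_re_normalQuotient hG hlim hz hcz
  · filter_upwards [hupper.eventually (gt_mem_nhds hc), Ioo_mem_nhdsLT one_pos] with r hlt hr
    have hle := hβ.1 (mem_image_of_mem _ (radius_mem_koranyi (n := n) hr).1)
    nlinarith [rate_radius (G := G) hr, hr.1]

/-- The defect of the normal quotient from a multiple of `(1 + ζ) / 2` along the slice `ℂ e₁`,
divided by `1 - ζ`. By `re_sliceDefect` its real part is nonnegative when `rate G ≤ β`. -/
def sliceDefect (G : Cn n → Cn n) (β : ℝ) (ζ : ℂ) : ℂ :=
  (β * (1 + ζ) / 2 - normalQuotient G (ζ • e 0)) / (1 - ζ)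

lemma re_sliceDefect (β : ℝ) (hζ : ‖ζ‖ < 1) : (sliceDefect G β ζ).re =
    (β - rate G (ζ • e 0)) / 2 * ((1 - ‖ζ‖ ^ 2) / ‖1 - ζ‖ ^ 2) := by
  have hsplit : sliceDefect G β ζ =
      ((β / 2 : ℝ) : ℂ) * ((1 + ζ) / (1 - ζ)) - normalQuotient G (ζ • e 0) / (1 - ζ) := by
    rw [sliceDefect]
    push_cast
    ring
  rw [hsplit, Complex.sub_re, Complex.re_ofReal_mul, re_one_add_div_one_sub]
  linarith [rate_smul_e_mul (G := G) hζ]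

lemma differentiableOn_sliceDefect (hG : DifferentiableOn ℂ G (ball n)) (β : ℝ) :
    DifferentiableOn ℂ (sliceDefect G β) (Metric.ball 0 1) := by
  have hslice : DifferentiableOn ℂ (fun ζ : ℂ => normalQuotient G (ζ • (e 0 : Cn n)))
      (Metric.ball 0 1) :=
    (differentiableOn_normalQuotient hG).comp
      (differentiable_id.smul_const (e 0 : Cn n)).differentiableOn
      fun ζ hζ => smul_e_mem_ball (mem_ball_zero_iff.1 hζ) 0
  have hmain : Differentiable ℂ fun ζ : ℂ => β * (1 + ζ) / 2 := by fun_prop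
  exact (hmain.differentiableOn.sub hslice).div (differentiableOn_id.const_sub 1)
    fun ζ hζ => one_sub_ne_zero_of_norm_lt_one (mem_ball_zero_iff.1 hζ)

theorem tendsto_normalQuotient_slice (hG : IsInfinitesimalGenerator G)
    (hlim : Tendsto (fun r : ℝ => G ((r : ℂ) • (e 0 : Cn n))) (𝓝[<] 1) (𝓝 0)) {β : ℝ}
    (hβ : IsLUB (rate G '' ball n) β) {ι : Type*} {l : Filter ι} {ζ : ι → ℂ}
    (hζlim : Tendsto ζ l (𝓝 1)) {C : ℝ}
    (hζ : ∀ᶠ k in l, ‖ζ k‖ < 1 ∧ ‖ζ k - 1‖ ≤ C * (1 - ‖ζ k‖ ^ 2)) :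
    Tendsto (fun k => normalQuotient G (ζ k • (e 0 : Cn n))) l (𝓝 β) := by
  have hre : ∀ ζ ∈ Metric.ball (0 : ℂ) 1, 0 ≤ (sliceDefect G β ζ).re := fun ζ hζ => by
    rw [mem_ball_zero_iff] at hζ
    have hrate := sub_nonneg.2 (hβ.1 (mem_image_of_mem _ (smul_e_mem_ball (n := n) hζ 0)))
    have hpos := one_sub_norm_sq_pos hζ
    rw [re_sliceDefect β hζ]
    positivity
  have hrad : Tendsto (fun r : ℝ => (1 - r) * (sliceDefect G β r).re) (𝓝[<] 1) (𝓝 0) := by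
    have hcont : Continuous fun r : ℝ => β * (1 + r) / 2 := by fun_prop
    have hsub := ((hcont.tendsto 1).mono_left nhdsWithin_le_nhds).sub
      (tendsto_re_normalQuotient_radius hG hlim hβ)
    rw [one_add_one_eq_two, mul_div_cancel_right₀ _ two_ne_zero, sub_self] at hsub
    refine hsub.congr' ?_
    filter_upwards [self_mem_nhdsWithin] with r (hr : r < 1)
    have hne : ((1 - r : ℝ) : ℂ) ≠ 0 := Complex.ofReal_ne_zero.2 (sub_pos.2 hr).ne'
    rw [← Complex.re_ofReal_mul, sliceDefect, ← Complex.ofReal_one, ← Complex.ofReal_sub,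
      mul_div_cancel₀ _ hne, Complex.sub_re]
    norm_cast
  have hzero := tendsto_one_sub_mul_of_re_nonneg (differentiableOn_sliceDefect hG.1 β) hre hrad
    hζlim hζ
  have hmain := ((hζlim.const_add 1).const_mul (β : ℂ)).div_const 2
  have hsub := hmain.sub hzero
  rw [one_add_one_eq_two, mul_div_cancel_right₀ _ two_ne_zero, sub_zero] at hsub
  refine hsub.congr' (hζ.mono fun k hk => ?_)
  rw [sliceDefect, mul_div_cancel₀ _ (one_sub_ne_zero_of_norm_lt_one hk.1)]
  ring

end Slice

lemma norm_sq_eq_slice_add (z : Cn n) :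
    ‖z‖ ^ 2 = ‖z 0‖ ^ 2 + ‖z - z 0 • (e 0 : Cn n)‖ ^ 2 := by
  have horth : inner ℂ (z 0 • (e 0 : Cn n)) (z - z 0 • (e 0 : Cn n)) = 0 := by
    rw [inner_smul_left, inner_e, PiLp.sub_apply, smul_e_apply_self, sub_self, mul_zero]
  have hpyth := norm_add_sq_eq_norm_sq_add_norm_sq_of_inner_eq_zero _ _ horth
  simpa only [add_sub_cancel, norm_smul_e, ← sq] using hpyth

section Weight

variable {R : ℝ} {z : Cn n}

/-- The exponent of `|1 - z₁|` giving the size of a Korányi region in the direction `e j`: it is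
`1` in the normal direction and `1 / 2` in the tangential ones. -/
def weight (j : Fin n) : ℝ := if j = 0 then 1 else 1 / 2

lemma weight_zero : weight (0 : Fin n) = 1 := if_pos rfl

lemma weight_of_ne_zero {j : Fin n} (hj : j ≠ 0) : weight j = 1 / 2 := if_neg hj

lemma weight_zero_sub_weight {j : Fin n} (hj : j ≠ 0) :
    weight (0 : Fin n) - weight j = 1 / 2 := by
  rw [weight_zero, weight_of_ne_zero hj]
  norm_num

lemma weight_pos (j : Fin n) : 0 < weight j := by
  unfold weight
  split_ifs <;> norm_num

lemma norm_apply_sq_le {j : Fin n} (hz : z ∈ ball n) (hj : j ≠ 0) :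
    ‖z j‖ ^ 2 ≤ 2 * ‖1 - z 0‖ := by
  have hz1 := mem_ball_iff.1 hz
  have hslice := norm_sq_eq_slice_add z
  have hj' : ‖z j‖ ≤ ‖z - z 0 • (e 0 : Cn n)‖ := by
    simpa [e_apply, hj] using PiLp.norm_apply_le (z - z 0 • (e 0 : Cn n)) j
  have hone : 1 - ‖z 0‖ ≤ ‖1 - z 0‖ := by simpa using norm_sub_norm_le (1 : ℂ) (z 0)
  have hsq := pow_le_pow_left₀ (norm_nonneg _) hj' 2
  nlinarith [norm_nonneg z, norm_nonneg (z 0), PiLp.norm_apply_le z 0]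

lemma sq_norm_rpow_half (a : ℂ) : (‖a‖ ^ (1 / 2 : ℝ)) ^ 2 = ‖a‖ := by
  rw [← Real.sqrt_eq_rpow, Real.sq_sqrt (norm_nonneg _)]

lemma norm_apply_mul_rpow_weight_le (hz : z ∈ ball n) (j : Fin n) :
    ‖z j‖ * ‖1 - z 0‖ ^ weight j ≤ 2 * ‖1 - z 0‖ := by
  obtain rfl | hj := eq_or_ne j 0
  · rw [weight_zero, Real.rpow_one]
    have hle := (PiLp.norm_apply_le z 0).trans (mem_ball_iff.1 hz).le
    gcongr
    linarith
  · rw [weight_of_ne_zero hj]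
    nlinarith [norm_apply_sq_le hz hj, sq_norm_rpow_half (1 - z 0),
      sq_nonneg (‖z j‖ - ‖1 - z 0‖ ^ (1 / 2 : ℝ))]

lemma sq_rpow_weight_le (hz : z ∈ ball n) (j : Fin n) :
    (‖1 - z 0‖ ^ weight j) ^ 2 ≤ 2 * ‖1 - z 0‖ := by
  obtain rfl | hj := eq_or_ne j 0
  · rw [weight_zero, Real.rpow_one, sq]
    have hle := (PiLp.norm_apply_le z 0).trans (mem_ball_iff.1 hz).le
    gcongr
    linarith [norm_sub_le 1 (z 0), norm_one (α := ℂ)]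
  · rw [weight_of_ne_zero hj, sq_norm_rpow_half]
    linarith [norm_nonneg (1 - z 0)]

lemma half_one_sub_norm_sq_le (hR : 1 ≤ R) (hz : z ∈ koranyi n R) (j : Fin n) {l : ℂ}
    (hl : ‖l‖ ≤ 1 / (8 * R) * ‖1 - z 0‖ ^ weight j) :
    (1 - ‖z‖ ^ 2) / 2 ≤ 1 - ‖z + l • (e j : Cn n)‖ ^ 2 := by
  have hR0 : 0 < R := one_pos.trans_le hR
  have hRl : R * ‖l‖ ≤ ‖1 - z 0‖ ^ weight j / 8 := by
    calc R * ‖l‖ ≤ R * (1 / (8 * R) * ‖1 - z 0‖ ^ weight j) := by gcongr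
      _ = ‖1 - z 0‖ ^ weight j / 8 := by field_simp
  have hl' : ‖l‖ ≤ ‖1 - z 0‖ ^ weight j / 8 := (le_mul_of_one_le_left (norm_nonneg l) hR).trans hRl
  have hcross : R * ‖l‖ * ‖z j‖ ≤ ‖1 - z 0‖ ^ weight j / 8 * ‖z j‖ := by gcongr
  have hsq : R * ‖l‖ * ‖l‖ ≤ ‖1 - z 0‖ ^ weight j / 8 * (‖1 - z 0‖ ^ weight j / 8) := by gcongr
  have hmain : R * (2 * (‖l‖ * ‖z j‖) + ‖l‖ ^ 2) ≤ R * ((1 - ‖z‖ ^ 2) / 2) := by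
    linarith [hz.2, norm_apply_mul_rpow_weight_le hz.1 j, sq_rpow_weight_le hz.1 j,
      norm_nonneg (1 - z 0)]
  linarith [le_of_mul_le_mul_left hmain hR0, norm_add_smul_e_sq_le z l j]

lemma norm_one_sub_add_smul_e_le (hR : 1 ≤ R) (z : Cn n) (j : Fin n) {l : ℂ}
    (hl : ‖l‖ ≤ 1 / (8 * R) * ‖1 - z 0‖ ^ weight j) :
    ‖1 - (z + l • (e j : Cn n)) 0‖ ≤ 2 * ‖1 - z 0‖ := by
  obtain rfl | hj := eq_or_ne j 0
  · rw [weight_zero, Real.rpow_one] at hl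
    have hl' : ‖l‖ ≤ ‖1 - z 0‖ :=
      hl.trans (mul_le_of_le_one_left (norm_nonneg _) (by rw [div_le_one] <;> linarith))
    rw [PiLp.add_apply, smul_e_apply_self, ← sub_sub]
    linarith [norm_sub_le (1 - z 0) l]
  · simp only [PiLp.add_apply, PiLp.smul_apply, e_apply, if_neg hj.symm, smul_zero, add_zero]
    linarith [norm_nonneg (1 - z 0)]

lemma add_smul_e_mem_koranyi (hR : 1 ≤ R) (hz : z ∈ koranyi n R) (j : Fin n) {l : ℂ}
    (hl : ‖l‖ ≤ 1 / (8 * R) * ‖1 - z 0‖ ^ weight j) :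
    z + l • (e j : Cn n) ∈ koranyi n (4 * R) := by
  have hhalf := half_one_sub_norm_sq_le hR hz j hl
  have hpos := one_sub_norm_sq_pos (mem_ball_iff.1 hz.1)
  refine ⟨mem_ball_iff.2 ((sq_lt_one_iff₀ (norm_nonneg _)).1 (by linarith)), ?_⟩
  calc _ ≤ 2 * (R / 2 * (1 - ‖z‖ ^ 2)) := by
        linarith [norm_one_sub_add_smul_e_le hR z j hl, hz.2]
    _ = 2 * R * ((1 - ‖z‖ ^ 2) / 2) := by ring
    _ ≤ 2 * R * (1 - ‖z + l • (e j : Cn n)‖ ^ 2) := by gcongr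
    _ = 4 * R / 2 * (1 - ‖z + l • (e j : Cn n)‖ ^ 2) := by ring

end Weight

section DerivativeBounds

variable {a : ℝ}

theorem IsKoranyiBigO.fderiv_apply_e {F : Type*} [NormedAddCommGroup F] [NormedSpace ℂ F]
    {f : Cn n → F} (h : IsKoranyiBigO a f) (ha : 0 ≤ a) (hf : DifferentiableOn ℂ f (ball n))
    (j : Fin n) : IsKoranyiBigO (a - weight j) fun z => fderiv ℂ f z (e j) := fun R hR => by
  obtain ⟨C, hC⟩ := h (4 * R) (by linarith)
  refine ⟨|C| * 2 ^ a * (8 * R), fun z hz => ?_⟩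
  have hpos := norm_one_sub_apply_pos hz
  have hρ : 0 < 1 / (8 * R) * ‖1 - z 0‖ ^ weight j := by positivity
  obtain ⟨l, hl, hle⟩ := exists_norm_fderiv_mul_le isOpen_ball hf hρ
    fun l hl => (add_smul_e_mem_koranyi hR hz j hl).1
  have hbound : ‖f (z + l • (e j : Cn n))‖ ≤ |C| * (2 ^ a * ‖1 - z 0‖ ^ a) := by
    rw [← Real.mul_rpow zero_le_two hpos.le]
    refine (hC _ (add_smul_e_mem_koranyi hR hz j hl.le)).trans ?_
    gcongr
    exacts [le_abs_self C, norm_one_sub_add_smul_e_le hR z j hl.le]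
  rw [Real.rpow_sub hpos, ← mul_div_assoc, le_div_iff₀ (Real.rpow_pos_of_pos hpos _)]
  calc ‖fderiv ℂ f z (e j)‖ * ‖1 - z 0‖ ^ weight j
      = ‖fderiv ℂ f z (e j)‖ * (1 / (8 * R) * ‖1 - z 0‖ ^ weight j) * (8 * R) := by field_simp
    _ ≤ |C| * (2 ^ a * ‖1 - z 0‖ ^ a) * (8 * R) := by
        exact mul_le_mul_of_nonneg_right (hle.trans hbound) (by positivity)
    _ = |C| * 2 ^ a * (8 * R) * ‖1 - z 0‖ ^ a := by ring

lemma IsKoranyiBigO.fderiv_apply_e_apply {G : Cn n → Cn n} {k : Fin n}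
    (h : IsKoranyiBigO (weight k) fun z => G z k) (hG : DifferentiableOn ℂ G (ball n))
    (j : Fin n) : IsKoranyiBigO (weight k - weight j) fun z => fderiv ℂ G z (e j) k :=
  fun R hR => by
  obtain ⟨C, hC⟩ := h.fderiv_apply_e (weight_pos k).le (differentiableOn_apply hG k) j R hR
  exact ⟨C, fun z hz => by simpa only [fderiv_apply_eq hG hz.1] using hC z hz⟩

lemma IsKoranyiBigO.cpow_mul {f : Cn n → ℂ} (h : IsKoranyiBigO a f) (b : ℝ) :
    IsKoranyiBigO (b + a) fun z => (1 - z 0) ^ (b : ℂ) * f z := fun R hR => by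
  obtain ⟨C, hC⟩ := h R hR
  refine ⟨C, fun z hz => ?_⟩
  rw [norm_mul, Complex.norm_cpow_real, Real.rpow_add (norm_one_sub_apply_pos hz), mul_left_comm]
  gcongr
  exact hC z hz

lemma IsKoranyiBigO.boundedInKoranyi_cpow_mul_fderiv {G : Cn n → Cn n} {k : Fin n}
    (h : IsKoranyiBigO (weight k) fun z => G z k) (hG : DifferentiableOn ℂ G (ball n))
    (j : Fin n) : BoundedInKoranyi fun z =>
      (1 - z 0) ^ ((weight j - weight k : ℝ) : ℂ) * fderiv ℂ G z (e j) k := by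
  have hweight := (h.fderiv_apply_e_apply hG j).cpow_mul (weight j - weight k)
  rw [sub_add_sub_cancel, sub_self] at hweight
  exact hweight.boundedInKoranyi

end DerivativeBounds

section RestrictedApproach

/-- A restricted approach to `e₁` whose slice coordinate is nontangential with constant `C`. The
conditions are only eventual, so that the notion does not depend on finitely many terms; they force
`z k` to be eventually in the ball and to converge to `e₁`. -/
structure IsRestrictedApproach (C : ℝ) (z : ℕ → Cn n) : Prop where
  tendsto_apply : Tendsto (fun k => z k 0) atTop (𝓝 1)
  tendsto_ratio :
    Tendsto (fun k => ‖z k - z k 0 • (e 0 : Cn n)‖ ^ 2 / (1 - ‖z k 0‖ ^ 2)) atTop (𝓝 0)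
  eventually_nontangential : ∀ᶠ k in atTop, ‖z k 0‖ < 1 ∧ ‖z k 0 - 1‖ ≤ C * (1 - ‖z k 0‖ ^ 2)

lemma mem_koranyi_of_nontangential {z : Cn n} {C : ℝ}
    (hv : ‖z - z 0 • (e 0 : Cn n)‖ ^ 2 ≤ (1 - ‖z 0‖ ^ 2) / 2)
    (hz : ‖z 0‖ < 1 ∧ ‖z 0 - 1‖ ≤ C * (1 - ‖z 0‖ ^ 2)) : z ∈ koranyi n (4 * C) := by
  have hslice := norm_sq_eq_slice_add z
  have hpos := one_sub_norm_sq_pos hz.1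
  have hC := half_le_of_nontangential hz.1 hz.2
  refine ⟨mem_ball_iff.2 ((sq_lt_one_iff₀ (norm_nonneg _)).1 (by linarith)), ?_⟩
  calc ‖1 - z 0‖ ≤ 2 * C * ((1 - ‖z 0‖ ^ 2) / 2) := by
        rw [norm_sub_rev]
        linarith [hz.2]
    _ ≤ 2 * C * (1 - ‖z‖ ^ 2) := by
        gcongr
        linarith
    _ = 4 * C / 2 * (1 - ‖z‖ ^ 2) := by ring

namespace IsRestrictedApproach

variable {C : ℝ} {z : ℕ → Cn n}

lemma half_le (h : IsRestrictedApproach C z) : 1 / 2 ≤ C :=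
  let ⟨_, hlt, hle⟩ := h.eventually_nontangential.exists
  half_le_of_nontangential hlt hle

lemma eventually_normal_lt (h : IsRestrictedApproach C z) : ∀ᶠ k in atTop,
    ‖z k - z k 0 • (e 0 : Cn n)‖ ^ 2 < (1 - ‖z k 0‖ ^ 2) / 2 := by
  filter_upwards [h.tendsto_ratio.eventually (gt_mem_nhds one_half_pos),
    h.eventually_nontangential] with k hratio hk
  rw [div_lt_iff₀ (one_sub_norm_sq_pos hk.1)] at hratio
  linarith

lemma eventually_mem_koranyi (h : IsRestrictedApproach C z) :
    ∀ᶠ k in atTop, z k ∈ koranyi n (4 * C) := by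
  filter_upwards [h.eventually_normal_lt, h.eventually_nontangential] with k hv hk
  exact mem_koranyi_of_nontangential hv.le hk

lemma one_le_four_mul (h : IsRestrictedApproach C z) : 1 ≤ 4 * C := by linarith [h.half_le]

lemma tendsto (h : IsRestrictedApproach C z) : Tendsto z atTop (𝓝 (e 0)) := by
  have hslice : Tendsto (fun k => z k 0 • (e 0 : Cn n)) atTop (𝓝 (e 0)) := by
    simpa using h.tendsto_apply.smul_const (e 0 : Cn n)
  have hsq : Tendsto (fun k => ‖z k - z k 0 • (e 0 : Cn n)‖ ^ 2) atTop (𝓝 0) := by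
    have hmul := h.tendsto_ratio.mul ((h.tendsto_apply.norm.pow 2).const_sub 1)
    rw [zero_mul] at hmul
    refine hmul.congr' (h.eventually_nontangential.mono fun k hk => ?_)
    exact div_mul_cancel₀ _ (one_sub_norm_sq_pos hk.1).ne'
  have hnormal : Tendsto (fun k => z k - z k 0 • (e 0 : Cn n)) atTop (𝓝 0) :=
    tendsto_zero_iff_norm_tendsto_zero.2 (by simpa using hsq.sqrt)
  simpa using hnormal.add hslice

end IsRestrictedApproach

lemma hasRestrictedKLimit_iff {f : Cn n → ℂ} {L : ℂ} : HasRestrictedKLimit f L ↔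
    ∀ (C : ℝ) (z : ℕ → Cn n), IsRestrictedApproach C z →
      Tendsto (fun k => f (z k)) atTop (𝓝 L) := by
  refine ⟨fun h C z hz => ?_, fun h z hz hlim hratio ⟨C, _, hC⟩ => h C z ⟨?_, hratio, ?_⟩⟩
  · obtain ⟨N, hN⟩ :=
      eventually_atTop.1 (hz.eventually_mem_koranyi.and hz.eventually_nontangential)
    have hshift (k : ℕ) := hN (k + N) (Nat.le_add_left N k)
    refine (tendsto_add_atTop_iff_nat N).1 (h (fun k => z (k + N)) (fun k => (hshift k).1.1)
      ((tendsto_add_atTop_iff_nat N).2 hz.tendsto)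
      ((tendsto_add_atTop_iff_nat N).2 hz.tendsto_ratio)
      ⟨C, by linarith [hz.half_le], fun k => (hshift k).2.2⟩)
  · have hcoord := ((hasFDerivAt_apply 0 (e 0 : Cn n)).continuousAt.tendsto).comp hlim
    simpa [Function.comp_def, e_apply] using hcoord
  · exact .of_forall fun k =>
      ⟨(PiLp.norm_apply_le (z k) 0).trans_lt (mem_ball_iff.1 (hz k)), hC k⟩

lemma IsKoranyiBigO.hasRestrictedKLimit_zero {f : Cn n → ℂ} {a : ℝ} (hf : IsKoranyiBigO a f)
    (ha : 0 < a) : HasRestrictedKLimit f 0 :=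
  hasRestrictedKLimit_iff.2 fun _ _ hz =>
    hf.tendsto_zero ha hz.one_le_four_mul hz.eventually_mem_koranyi hz.tendsto_apply

end RestrictedApproach

section SliceComparison

variable {f : Cn n → ℂ} {C M : ℝ}

lemma norm_sub_slice_sq_le (y : Cn n) : ‖y - y 0 • (e 0 : Cn n)‖ ^ 2 ≤ ‖y‖ ^ 2 := by
  linarith [norm_sq_eq_slice_add y, sq_nonneg ‖y 0‖]

-- The Schwarz lemma on the transverse ball of radius `√((1 - |z₁|²) / 2)` about `z₁ e₁`.
lemma norm_sub_apply_slice_le (hf : DifferentiableOn ℂ f (ball n))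
    (hM : ∀ z ∈ koranyi n (4 * C), ‖f z‖ ≤ M) {z : Cn n}
    (hv : ‖z - z 0 • (e 0 : Cn n)‖ ^ 2 < (1 - ‖z 0‖ ^ 2) / 2)
    (hz : ‖z 0‖ < 1 ∧ ‖z 0 - 1‖ ≤ C * (1 - ‖z 0‖ ^ 2)) :
    ‖f z - f (z 0 • e 0)‖ ≤
      2 * M * √(2 * (‖z - z 0 • (e 0 : Cn n)‖ ^ 2 / (1 - ‖z 0‖ ^ 2))) := by
  have hpos := one_sub_norm_sq_pos hz.1
  set s := √((1 - ‖z 0‖ ^ 2) / 2)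
  have hs : s ^ 2 = (1 - ‖z 0‖ ^ 2) / 2 := Real.sq_sqrt (by positivity)
  let φ : Cn n → Cn n := fun y => z 0 • e 0 + (y - y 0 • e 0)
  have hφ0 (y : Cn n) : φ y 0 = z 0 := by simp [φ, e_apply]
  have hφ : Differentiable ℂ φ := fun y =>
    (differentiableAt_id.sub ((hasFDerivAt_apply 0 y).differentiableAt.smul_const _)).const_add _
  have hφ_mem : ∀ y ∈ Metric.ball (0 : Cn n) s, φ y ∈ koranyi n (4 * C) := fun y hy => by
    refine mem_koranyi_of_nontangential ?_ (by rwa [hφ0])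
    rw [hφ0, add_sub_cancel_left, ← hs]
    exact (norm_sub_slice_sq_le y).trans
      (pow_le_pow_left₀ (norm_nonneg y) (mem_ball_zero_iff.1 hy).le 2)
  have hzero : φ 0 = z 0 • e 0 := by simp [φ]
  have hnormal : φ (z - z 0 • e 0) = z := by simp [φ, e_apply]
  have hschwarz := HolomorphicFlow.norm_sub_le_of_norm_le
    (hf.comp hφ.differentiableOn fun y hy => (hφ_mem y hy).1) (fun y hy => hM _ (hφ_mem y hy))
    (mem_ball_zero_iff.2 (Real.lt_sqrt_of_sq_lt hv))
  rw [Function.comp_apply, hnormal, Function.comp_apply, hzero, sub_zero] at hschwarz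
  refine hschwarz.trans_eq ?_
  rw [div_mul_eq_mul_div, mul_div_assoc, ← Real.sqrt_sq (norm_nonneg (z - z 0 • e 0)),
    ← Real.sqrt_div (sq_nonneg _), Real.sq_sqrt (sq_nonneg _)]
  congr 2
  field_simp

theorem hasRestrictedKLimit_of_slice {L : ℂ} (hf : DifferentiableOn ℂ f (ball n))
    (hbdd : BoundedInKoranyi f)
    (hslice : ∀ (C : ℝ) (ζ : ℕ → ℂ), Tendsto ζ atTop (𝓝 1) →
      (∀ᶠ k in atTop, ‖ζ k‖ < 1 ∧ ‖ζ k - 1‖ ≤ C * (1 - ‖ζ k‖ ^ 2)) →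
      Tendsto (fun k => f (ζ k • (e 0 : Cn n))) atTop (𝓝 L)) :
    HasRestrictedKLimit f L := hasRestrictedKLimit_iff.2 fun C z hz => by
  obtain ⟨M, hM⟩ := hbdd (4 * C) hz.one_le_four_mul
  have hbound := (hz.tendsto_ratio.const_mul 2).sqrt.const_mul (2 * M)
  rw [mul_zero, Real.sqrt_zero, mul_zero] at hbound
  have hdiff : Tendsto (fun k => f (z k) - f (z k 0 • e 0)) atTop (𝓝 0) := by
    refine squeeze_zero_norm' ?_ hbound
    filter_upwards [hz.eventually_normal_lt, hz.eventually_nontangential] with k hv hk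
    exact norm_sub_apply_slice_le hf hM hv hk
  simpa using hdiff.add (hslice C _ hz.tendsto_apply hz.eventually_nontangential)

end SliceComparison

section NormalDerivative

variable {C : ℝ}

lemma half_one_sub_norm_apply_add_sq_le {z : Cn n} {l : ℂ}
    (hz : ‖z 0‖ < 1 ∧ ‖z 0 - 1‖ ≤ C * (1 - ‖z 0‖ ^ 2))
    (hl : ‖l‖ ≤ 1 / (8 * (4 * C)) * ‖1 - z 0‖ ^ weight (0 : Fin n)) :
    (1 - ‖z 0‖ ^ 2) / 2 ≤ 1 - ‖z 0 + l‖ ^ 2 := by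
  have hmem : z 0 • (e 0 : Cn n) ∈ koranyi n (4 * C) := by
    refine mem_koranyi_of_nontangential ?_ (by rwa [smul_e_apply_self])
    rw [smul_e_apply_self, sub_self, norm_zero, zero_pow two_ne_zero]
    exact (half_pos (one_sub_norm_sq_pos hz.1)).le
  have hle := half_one_sub_norm_sq_le (by linarith [half_le_of_nontangential hz.1 hz.2]) hmem 0
    (by rwa [smul_e_apply_self])
  rwa [← add_smul, norm_smul_e, norm_smul_e] at hle

lemma IsRestrictedApproach.add_normal {z : ℕ → Cn n} (h : IsRestrictedApproach C z) {l : ℕ → ℂ}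
    (hl : ∀ᶠ k in atTop, ‖l k‖ ≤ 1 / (8 * (4 * C)) * ‖1 - z k 0‖ ^ weight (0 : Fin n)) :
    IsRestrictedApproach (4 * C) fun k => z k + l k • e 0 := by
  have hR := h.one_le_four_mul
  have happly (k : ℕ) : (z k + l k • (e 0 : Cn n)) 0 = z k 0 + l k := by simp [e_apply]
  have hnormal (k : ℕ) : z k + l k • e 0 - (z k + l k • (e 0 : Cn n)) 0 • e 0 =
      z k - z k 0 • (e 0 : Cn n) := by
    rw [happly, add_smul]
    abel
  have hhalf : ∀ᶠ k in atTop, 0 < 1 - ‖z k 0‖ ^ 2 ∧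
      (1 - ‖z k 0‖ ^ 2) / 2 ≤ 1 - ‖z k 0 + l k‖ ^ 2 := by
    filter_upwards [h.eventually_nontangential, hl] with k hk hlk
    exact ⟨one_sub_norm_sq_pos hk.1, half_one_sub_norm_apply_add_sq_le hk hlk⟩
  have hl0 : Tendsto l atTop (𝓝 0) := by
    have hbound : Tendsto (fun k => 1 / (8 * (4 * C)) * ‖1 - z k 0‖) atTop (𝓝 0) := by
      simpa using ((h.tendsto_apply.const_sub 1).norm).const_mul (1 / (8 * (4 * C)))
    refine squeeze_zero_norm' (hl.mono fun k hk => ?_) hbound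
    rwa [weight_zero, Real.rpow_one] at hk
  refine ⟨by simpa [happly] using h.tendsto_apply.add hl0, ?_, ?_⟩
  · have hratio := h.tendsto_ratio.const_mul 2
    rw [mul_zero] at hratio
    simp only [hnormal]
    simp only [happly]
    refine squeeze_zero' (hhalf.mono fun k ⟨hpos, hle⟩ => ?_)
      (hhalf.mono fun k ⟨hpos, hle⟩ => ?_) hratio
    · have hpos' : 0 < 1 - ‖z k 0 + l k‖ ^ 2 := (half_pos hpos).trans_le hle
      positivity
    · calc _ ≤ ‖z k - z k 0 • (e 0 : Cn n)‖ ^ 2 / ((1 - ‖z k 0‖ ^ 2) / 2) := by gcongr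
        _ = 2 * (‖z k - z k 0 • (e 0 : Cn n)‖ ^ 2 / (1 - ‖z k 0‖ ^ 2)) := by
          field_simp
  · filter_upwards [h.eventually_nontangential, hl, hhalf] with k hk hlk ⟨hpos, hle⟩
    have hdist := norm_one_sub_add_smul_e_le hR (z k) 0 hlk
    rw [happly, norm_sub_rev, norm_sub_rev 1] at hdist
    rw [happly]
    refine ⟨(sq_lt_one_iff₀ (norm_nonneg _)).1 (by linarith), ?_⟩
    nlinarith [hk.2]

theorem HasRestrictedKLimit.mul_fderiv {f : Cn n → ℂ} {L : ℂ} (h : HasRestrictedKLimit f L)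
    (hf : DifferentiableOn ℂ f (ball n)) :
    HasRestrictedKLimit (fun z => (z 0 - 1) * fderiv ℂ f z (e 0)) 0 :=
  hasRestrictedKLimit_iff.2 fun C z hz => by
  have hR := hz.one_le_four_mul
  have hC : 0 < C := by linarith
  have hcauchy : ∀ᶠ k in atTop, ∃ l : ℂ,
      ‖l‖ = 1 / (8 * (4 * C)) * ‖1 - z k 0‖ ^ weight (0 : Fin n) ∧
      ‖fderiv ℂ f (z k) (e 0)‖ * (1 / (8 * (4 * C)) * ‖1 - z k 0‖ ^ weight (0 : Fin n)) ≤
        ‖f (z k + l • e 0) - L‖ := by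
    filter_upwards [hz.eventually_mem_koranyi] with k hk
    have hpos := norm_one_sub_apply_pos hk
    have hmain := exists_norm_fderiv_mul_le isOpen_ball (hf.sub_const L)
      (ρ := 1 / (8 * (4 * C)) * ‖1 - z k 0‖ ^ weight (0 : Fin n)) (by positivity)
      fun l hl => (add_smul_e_mem_koranyi hR hk 0 hl).1
    rwa [fderiv_sub_const] at hmain
  obtain ⟨l, hl⟩ := hcauchy.choice
  have hlim := hasRestrictedKLimit_iff.1 h _ _ (hz.add_normal (hl.mono fun k hk => hk.1.le))
  have hbound := ((hlim.sub_const L).norm).const_mul (8 * (4 * C))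
  rw [sub_self, norm_zero, mul_zero] at hbound
  refine squeeze_zero_norm' (hl.mono fun k ⟨_, hk⟩ => ?_) hbound
  rw [weight_zero, Real.rpow_one] at hk
  calc ‖(z k 0 - 1) * fderiv ℂ f (z k) (e 0)‖
      = 8 * (4 * C) *
          (‖fderiv ℂ f (z k) (e 0)‖ * (1 / (8 * (4 * C)) * ‖1 - z k 0‖)) := by
        rw [norm_mul, norm_sub_rev]
        field_simp
    _ ≤ 8 * (4 * C) * ‖f (z k + l k • e 0) - L‖ := by gcongr

variable {G : Cn n → Cn n}

lemma fderiv_apply_zero_eq (hG : DifferentiableOn ℂ G (ball n)) {z : Cn n} (hz : z ∈ ball n) :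
    fderiv ℂ G z (e 0) 0 =
      normalQuotient G z + (z 0 - 1) * fderiv ℂ (normalQuotient G) z (e 0) := by
  have hnhds := isOpen_ball.mem_nhds hz
  have hq := ((differentiableOn_normalQuotient hG).differentiableAt hnhds).hasFDerivAt
  have heq : (fun w : Cn n => G w 0) =ᶠ[𝓝 z] fun w => (w 0 - 1) * normalQuotient G w := by
    filter_upwards [hnhds] with w hw
    rw [normalQuotient, mul_div_cancel₀ _ (apply_sub_one_ne_zero hw)]
  rw [← fderiv_apply_eq hG hz, heq.fderiv_eq,
    (((hasFDerivAt_apply 0 z).sub_const 1).fun_mul hq).fderiv]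
  simp [e_apply, add_comm]

theorem HasRestrictedKLimit.fderiv_apply_zero {L : ℂ}
    (h : HasRestrictedKLimit (normalQuotient G) L) (hG : DifferentiableOn ℂ G (ball n)) :
    HasRestrictedKLimit (fun z => fderiv ℂ G z (e 0) 0) L :=
  hasRestrictedKLimit_iff.2 fun C z hz => by
  have hsum := (hasRestrictedKLimit_iff.1 h C z hz).add
    (hasRestrictedKLimit_iff.1 (h.mul_fderiv (differentiableOn_normalQuotient hG)) C z hz)
  rw [add_zero] at hsum
  exact hsum.congr' (hz.eventually_mem_koranyi.mono fun k hk => (fderiv_apply_zero_eq hG hk.1).symm)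

end NormalDerivative

section Generator

variable {G : Cn n → Cn n}

lemma boundedInKoranyi_normalQuotient
    (h : IsKoranyiBigO 1 fun z => G z 0) : BoundedInKoranyi (normalQuotient G) := by
  simpa [BoundedInKoranyi, normalQuotient] using boundedInKoranyi_norm_div_rpow_iff.2 h

lemma tendsto_radius_zero (h : ∀ k, IsKoranyiBigO (weight k) fun z => G z k) :
    Tendsto (fun r : ℝ => G ((r : ℂ) • (e 0 : Cn n))) (𝓝[<] 1) (𝓝 0) := by
  have hcoord (k : Fin n) :=
    (h k).tendsto_zero (weight_pos k) one_le_two eventually_radius_mem_koranyi tendsto_radius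
  refine tendsto_zero_iff_norm_tendsto_zero.2 ?_
  simpa [EuclideanSpace.norm_eq] using
    (tendsto_finsetSum Finset.univ fun k _ => (hcoord k).norm.pow 2).sqrt

lemma bddAbove_rate_of_isKoranyiBigO (hG : IsInfinitesimalGenerator G)
    (h : ∀ k, IsKoranyiBigO (weight k) fun z => G z k) : BddAbove (rate G '' ball n) := by
  obtain ⟨C, hC⟩ := boundedInKoranyi_normalQuotient (by simpa [weight_zero] using h 0) 2 one_le_two
  exact bddAbove_rate hG (tendsto_radius_zero h) (eventually_radius_mem_koranyi.mono fun r hr =>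
    (Complex.re_le_norm _).trans (hC _ hr))

theorem hasRestrictedKLimit_normalQuotient (hG : IsInfinitesimalGenerator G)
    (h : ∀ k, IsKoranyiBigO (weight k) fun z => G z k) {β : ℝ}
    (hβ : IsLUB (rate G '' ball n) β) : HasRestrictedKLimit (normalQuotient G) β :=
  hasRestrictedKLimit_of_slice (differentiableOn_normalQuotient hG.1)
    (boundedInKoranyi_normalQuotient (by simpa [weight_zero] using h 0))
    fun _ _ hlim hζ => tendsto_normalQuotient_slice hG (tendsto_radius_zero h) hβ hlim hζ

end Generator

end UnitBall

end

theorem theorem1p2 (n : ℕ) [NeZero n] (G : UnitBall.Cn n → UnitBall.Cn n)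
    (hG : UnitBall.IsInfinitesimalGenerator G)
    (h₁ : UnitBall.BoundedInKoranyi (fun z : UnitBall.Cn n => ‖G z 0‖ / ‖z 0 - 1‖))
    (h₂ : ∀ j : Fin n, j ≠ 0 →
      UnitBall.BoundedInKoranyi
        (fun z : UnitBall.Cn n => ‖G z j‖ / ‖z 0 - 1‖ ^ (1 / 2 : ℝ))) :
    UnitBall.IsBRNP G ∧
    -- (1')
    UnitBall.BoundedInKoranyi (fun z : UnitBall.Cn n => fderiv ℂ G z (UnitBall.e 0) 0) ∧
    (∀ h k : Fin n, h ≠ 0 → k ≠ 0 →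
      UnitBall.BoundedInKoranyi (fun z : UnitBall.Cn n => fderiv ℂ G z (UnitBall.e h) k)) ∧
    -- (1'')
    (∀ j : Fin n, j ≠ 0 →
      UnitBall.BoundedInKoranyi
        (fun z : UnitBall.Cn n => fderiv ℂ G z (UnitBall.e j) 0 / (1 - z 0) ^ (1 / 2 : ℂ))) ∧
    -- (1''')
    (∀ j : Fin n, j ≠ 0 →
      UnitBall.BoundedInKoranyi
        (fun z : UnitBall.Cn n => (1 - z 0) ^ (1 / 2 : ℂ) * fderiv ℂ G z (UnitBall.e 0) j)) ∧
    -- (2)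
    UnitBall.HasRestrictedKLimit
      (fun z : UnitBall.Cn n => G z 0 / (z 0 - 1)) (UnitBall.dilation G : ℂ) ∧
    -- (3)
    UnitBall.HasRestrictedKLimit
      (fun z : UnitBall.Cn n => fderiv ℂ G z (UnitBall.e 0) 0) (UnitBall.dilation G : ℂ) ∧
    -- (4)
    (∀ j : Fin n, j ≠ 0 →
      UnitBall.HasRestrictedKLimit
        (fun z : UnitBall.Cn n => fderiv ℂ G z (UnitBall.e j) 0) 0) := by
  have hO : ∀ k, UnitBall.IsKoranyiBigO (UnitBall.weight k) fun z => G z k := fun k => by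
    refine UnitBall.boundedInKoranyi_norm_div_rpow_iff.1 ?_
    obtain rfl | hk := eq_or_ne k 0
    · simpa only [UnitBall.weight_zero, Real.rpow_one] using h₁
    · simpa only [UnitBall.weight_of_ne_zero hk] using h₂ k hk
  have hderiv (j k : Fin n) := (hO k).boundedInKoranyi_cpow_mul_fderiv hG.1 j
  have hrate := UnitBall.bddAbove_rate_of_isKoranyiBigO hG hO
  have hq : UnitBall.HasRestrictedKLimit (UnitBall.normalQuotient G) (UnitBall.dilation G) :=
    UnitBall.hasRestrictedKLimit_normalQuotient hG hO (UnitBall.isLUB_dilation hrate)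
  refine ⟨UnitBall.isBRNP_of_bddAbove_rate hrate, ?_, fun h k hh hk => ?_, fun j hj => ?_,
    fun j hj => ?_, hq, hq.fderiv_apply_zero hG.1, fun j hj => ?_⟩
  · simpa using hderiv 0 0
  · simpa [UnitBall.weight_of_ne_zero hh, UnitBall.weight_of_ne_zero hk] using hderiv h k
  · have hexp : UnitBall.weight j - UnitBall.weight (0 : Fin n) = -(1 / 2) := by
      rw [← neg_sub, UnitBall.weight_zero_sub_weight hj]
    simpa [hexp, Complex.cpow_neg, div_eq_inv_mul] using hderiv j 0
  · simpa [UnitBall.weight_zero_sub_weight hj] using hderiv 0 j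
  · refine ((hO 0).fderiv_apply_e_apply hG.1 j).hasRestrictedKLimit_zero ?_
    rw [UnitBall.weight_zero_sub_weight hj]
    norm_num
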